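/- Let $d\ge 3$ be an integer. For $\theta\in\mathbb R$ let $\gamma_\theta$ be the ray $\gamma_\theta(t)=te^{i\theta}$ $(0<t<\infty)$. For $n\ge 1$ and $\theta,\theta',\phi\in\mathbb R$ put $$\varphi_\theta(w)=\frac1{\sqrt{2\pi}}\int_{\gamma_\theta}\exp\Bigl(iwz^d-\frac{z^2}{2}\Bigr)\,dz,\qquad \psi(z;\theta,\theta',\phi)=\int_{\gamma_\phi}e^{-iwz}\bigl(\varphi_\theta(w)-\varphi_{\theta'}(w)\bigr)^n\,dw$$ whenever these integrals converge absolutely (in the second one, $\varphi_\theta(w)$ and $\varphi_{\theta'}(w)$ are required to converge absolutely at every point $w$ of $\gamma_\phi$). There is $\varepsilon_0>0$, depending only on $d$, such that the following holds for every $n\ge1$. Let $X_1,\dots,X_n$ be independent standard normal random variables and $X=\sum_{k=1}^nX_k^d$. Then $X$ has a probability density function $f_X$ with respect to Lebesgue measure such that $f_X(x)=\frac{d}{dx}P(X<x)$ for every $x\neq0$, and for every $0<\varepsilon<\varepsilon_0$ all the integrals below converge absolutely and the following formulas hold. If $d$ is odd, $$f_X(x)=\begin{cases}\dfrac1{2\pi}\bigl(\psi(x;\varepsilon,\pi,-\varepsilon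 d)-\psi(x;-\varepsilon,\pi,\pi+\varepsilon d)\bigr)&(x>0),\\[2mm]\dfrac1{2\pi}\bigl(\psi(x;0,\pi-\varepsilon,\varepsilon d)-\psi(x;0,\pi+\varepsilon,\pi-\varepsilon d)\bigr)&(x<0).\end{cases}$$ If $d$ is even, $$f_X(x)=\begin{cases}\dfrac1{2\pi}\bigl(\psi(x;\varepsilon,\pi+\varepsilon,-\varepsilon d)-\psi(x;-\varepsilon,\pi-\varepsilon,\pi+\varepsilon d)\bigr)&(x>0),\\[2mm]\dfrac1{2\pi}\bigl(\psi(x;0,\pi,\varepsilon d)-\psi(x;0,\pi,\pi-\varepsilon d)\bigr)&(x<0).\end{cases}$$ -/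

import Mathlib

open MeasureTheory ProbabilityTheory Set

noncomputable section

namespace PoweredNormal

/-- The ray `γ_θ(t) = t e^{iθ}`, traversed for `0 < t < ∞`. -/
def ray (θ t : ℝ) : ℂ := (t : ℂ) * Complex.exp (Complex.I * (θ : ℂ))

/-- The pulled-back integrand `g(γ_θ(t)) γ_θ'(t)` of the contour integral of `g` along `γ_θ`. -/
def rayIntegrand (θ : ℝ) (g : ℂ → ℂ) (t : ℝ) : ℂ :=
  g (ray θ t) * Complex.exp (Complex.I * (θ : ℂ))

/-- Absolute convergence of the contour integral of `g` along `γ_θ`. -/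
def RayIntegrable (θ : ℝ) (g : ℂ → ℂ) : Prop :=
  IntegrableOn (rayIntegrand θ g) (Ioi (0 : ℝ)) volume

/-- The contour integral `∫_{γ_θ} g(z) dz`. -/
def rayIntegral (θ : ℝ) (g : ℂ → ℂ) : ℂ :=
  ∫ t in Ioi (0 : ℝ), rayIntegrand θ g t

/-- The integrand `exp(i w z^d - z^2/2)`. -/
def phiKernel (d : ℕ) (w z : ℂ) : ℂ :=
  Complex.exp (Complex.I * w * z ^ d - z ^ 2 / 2)

/-- `φ_θ(w) = (2π)^{-1/2} ∫_{γ_θ} exp(i w z^d - z^2/2) dz`. -/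
def phi (d : ℕ) (θ : ℝ) (w : ℂ) : ℂ :=
  1 / (Real.sqrt (2 * Real.pi) : ℂ) * rayIntegral θ (phiKernel d w)

/-- The integrand `e^{-i w z} (φ_θ(w) - φ_θ'(w))^n`. -/
def psiKernel (d n : ℕ) (z : ℂ) (θ θ' : ℝ) (w : ℂ) : ℂ :=
  Complex.exp (-(Complex.I * w * z)) * (phi d θ w - phi d θ' w) ^ n

/-- `ψ(z; θ, θ', φ) = ∫_{γ_φ} e^{-i w z} (φ_θ(w) - φ_θ'(w))^n dw`; here `α` is the angle `φ`. -/
def psi (d n : ℕ) (z : ℂ) (θ θ' α : ℝ) : ℂ :=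
  rayIntegral α (psiKernel d n z θ θ')

/-- All the integrals in `ψ(z; θ, θ', φ)` converge absolutely: those of `φ_θ(w)` and `φ_θ'(w)` for
every `w` on the ray `γ_φ`, and the outer one. -/
def PsiConverges (d n : ℕ) (z : ℂ) (θ θ' α : ℝ) : Prop :=
  (∀ t : ℝ, 0 < t →
    RayIntegrable θ (phiKernel d (ray α t)) ∧ RayIntegrable θ' (phiKernel d (ray α t))) ∧
  RayIntegrable α (psiKernel d n z θ θ')

/-- The value `y` is given by the formula
`y = (2π)⁻¹ (ψ(x; θ₁, θ₁', φ₁) - ψ(x; θ₂, θ₂', φ₂))`, with all its integrals convergent. -/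
def GivenByContours (d n : ℕ) (x y : ℝ) (θ₁ θ₁' α₁ θ₂ θ₂' α₂ : ℝ) : Prop :=
  PsiConverges d n x θ₁ θ₁' α₁ ∧ PsiConverges d n x θ₂ θ₂' α₂ ∧
    (y : ℂ) = 1 / (2 * Real.pi : ℂ) * (psi d n x θ₁ θ₁' α₁ - psi d n x θ₂ θ₂' α₂)

/-- `f` is the density of the real random variable `S`: it is a density with respect to
Lebesgue measure, and away from `0` it is, pointwise, the derivative of `c ↦ P(S < c)`. -/
structure IsDensityAwayFromZero {Ω : Type*} [MeasurableSpace Ω] (P : Measure Ω) (S : Ω → ℝ)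
    (f : ℝ → ℝ) : Prop where
  nonneg : ∀ x, 0 ≤ f x
  measurable : Measurable f
  map_eq : P.map S = (volume : Measure ℝ).withDensity (fun x => ENNReal.ofReal (f x))
  hasDerivAt : ∀ x, x ≠ 0 → HasDerivAt (fun c : ℝ => P.real {ω | S ω < c}) (f x) x

end PoweredNormal

end

noncomputable section

namespace PoweredNormal

open Filter Topology

/-! The characteristic function of the sum is `(φ_0 - φ_π) ^ n` on the real line, but it need not be
integrable, so Fourier inversion is not directly available. Instead each half-line Fourier integral
is damped by `e^{-δt}`. The two damped halves add up to the Poisson integral of the law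
(`integral_exp_mul_charFun_add`) and are also `ψ(x - iδ; 0, π, 0)` and `-ψ(x + iδ; 0, π, π)`.

For `δ > 0` Cauchy's theorem (`rayIntegral_eq_rayIntegral`) turns the outer rays to angles where
`e^{-iwx}` decays by itself. Now `φ_θ(w)` converges for `Im (w e^{idθ}) ≥ 0` when `cos 2θ > 0`. An
outer ray that would leave this half-plane is followed by first turning the inner ray by `±ε`, which
moves the half-plane by `εd` (`IsContinuation`). The turned integrals are continuous down to `δ =
0`, and Stieltjes inversion (`integral_boundary_values`) shows that their boundary values integrate
to increments of `2π P(X < x)`. Hence the distribution function is differentiable off `0`, with the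
stated derivative. The law is absolutely continuous, so this derivative is its density. -/

/-- The closed sector `a ≤ arg w ≤ b`, without its vertex. -/
def sector (a b : ℝ) : Set ℂ := {w | ∃ θ ∈ Icc a b, ∃ r : ℝ, 0 < r ∧ ray θ r = w}

lemma ray_mem_sector {a b θ r : ℝ} (hθ : θ ∈ Icc a b) (hr : 0 < r) : ray θ r ∈ sector a b :=
  ⟨θ, hθ, r, hr, rfl⟩

/-! ### Ray integrals and rotation of contours -/

lemma exp_add_mul_I_eq_ray (x θ : ℝ) :
    Complex.exp (x + θ * Complex.I) = ray θ (Real.exp x) := by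
  rw [ray, Complex.exp_add, Complex.ofReal_exp, mul_comm (θ : ℂ)]

lemma norm_exp_I_mul (θ : ℝ) : ‖Complex.exp (Complex.I * (θ : ℂ))‖ = 1 := by
  rw [mul_comm, Complex.norm_exp_ofReal_mul_I]

lemma norm_rayIntegrand (θ : ℝ) (g : ℂ → ℂ) (t : ℝ) : ‖rayIntegrand θ g t‖ = ‖g (ray θ t)‖ := by
  rw [rayIntegrand, norm_mul, norm_exp_I_mul, mul_one]

lemma exp_smul_rayIntegrand (θ : ℝ) (g : ℂ → ℂ) (x : ℝ) :
    Real.exp x • rayIntegrand θ g (Real.exp x) =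
      g (Complex.exp (x + θ * Complex.I)) * Complex.exp (x + θ * Complex.I) := by
  rw [exp_add_mul_I_eq_ray, rayIntegrand, Complex.real_smul, ray]
  ring

/-- The substitution `t = e^x` straightens rays into horizontal lines and sectors into strips, with
the vertex at `-∞`; rotation then becomes Cauchy's theorem on rectangles. -/
lemma rayIntegral_eq_integral_exp (θ : ℝ) (g : ℂ → ℂ) :
    rayIntegral θ g =
      ∫ x : ℝ, g (Complex.exp (x + θ * Complex.I)) * Complex.exp (x + θ * Complex.I) := by
  have := integral_image_eq_integral_abs_deriv_smul MeasurableSet.univ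
    (fun x _ ↦ (Real.hasDerivAt_exp x).hasDerivWithinAt) Real.exp_injective.injOn
    (rayIntegrand θ g)
  simp only [image_univ, Real.range_exp, Real.abs_exp, Measure.restrict_univ,
    exp_smul_rayIntegrand] at this
  exact this

lemma rayIntegrable_iff_integrable_exp (θ : ℝ) (g : ℂ → ℂ) :
    RayIntegrable θ g ↔
      Integrable fun x : ℝ =>
        g (Complex.exp (x + θ * Complex.I)) * Complex.exp (x + θ * Complex.I) := by
  have := integrableOn_image_iff_integrableOn_abs_deriv_smul MeasurableSet.univ
    (fun x _ ↦ (Real.hasDerivAt_exp x).hasDerivWithinAt) Real.exp_injective.injOn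
    (rayIntegrand θ g)
  simp only [image_univ, Real.range_exp, Real.abs_exp, integrableOn_univ,
    exp_smul_rayIntegrand] at this
  exact this

lemma continuous_ray (θ : ℝ) : Continuous (ray θ) := by
  unfold ray; fun_prop

lemma continuousOn_rayIntegrand {a b θ : ℝ} (hθ : θ ∈ Icc a b) {g : ℂ → ℂ}
    (hg : ContinuousOn g (sector a b)) : ContinuousOn (rayIntegrand θ g) (Ioi 0) := by
  unfold rayIntegrand
  refine ContinuousOn.mul ?_ continuousOn_const
  exact hg.comp (continuous_ray θ).continuousOn fun t ht => ray_mem_sector hθ ht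

lemma integrableOn_const_mul_exp_neg {c : ℝ} (hc : 0 < c) (C : ℝ) :
    IntegrableOn (fun r : ℝ => C * Real.exp (-c * r)) (Ioi 0) :=
  (integrableOn_exp_mul_Ioi (neg_lt_zero.2 hc) 0).const_mul C

lemma rayIntegrable_of_norm_le {a b θ : ℝ} (hθ : θ ∈ Icc a b) {g : ℂ → ℂ} {C c : ℝ} (hc : 0 < c)
    (hg : ContinuousOn g (sector a b))
    (hb : ∀ r : ℝ, 0 < r → ‖g (ray θ r)‖ ≤ C * Real.exp (-c * r)) : RayIntegrable θ g := by
  refine (integrableOn_const_mul_exp_neg hc C).mono'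
    ((continuousOn_rayIntegrand hθ hg).aestronglyMeasurable measurableSet_Ioi) ?_
  filter_upwards [ae_restrict_mem measurableSet_Ioi] with r hr
  rw [norm_rayIntegrand]
  exact hb r hr

lemma tendsto_mul_exp_neg_mul_atTop {c : ℝ} (hc : 0 < c) (C : ℝ) :
    Tendsto (fun r : ℝ => C * Real.exp (-c * r) * r) atTop (𝓝 0) := by
  have := (tendsto_rpow_mul_exp_neg_mul_atTop_nhds_zero 1 c hc).const_mul C
  simp only [Real.rpow_one, mul_zero] at this
  exact this.congr fun r => by ring

lemma tendsto_mul_exp_neg_mul_zero (c C : ℝ) :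
    Tendsto (fun r : ℝ => C * Real.exp (-c * r) * r) (𝓝 0) (𝓝 0) := by
  have : Continuous fun r : ℝ => C * Real.exp (-c * r) * r := by fun_prop
  simpa using this.tendsto 0

/-- Rotation of the contour: the integrals along the two sides of a sector agree. -/
theorem rayIntegral_eq_rayIntegral {a b : ℝ} (hab : a ≤ b) {g : ℂ → ℂ} {C c : ℝ} (hc : 0 < c)
    (hg : ContinuousOn g (sector a b))
    (hd : ∀ θ ∈ Ioo a b, ∀ r : ℝ, 0 < r → DifferentiableAt ℂ g (ray θ r))
    (hb : ∀ θ ∈ Icc a b, ∀ r : ℝ, 0 < r → ‖g (ray θ r)‖ ≤ C * Real.exp (-c * r)) :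
    rayIntegral a g = rayIntegral b g := by
  set G : ℂ → ℂ := fun u => g (Complex.exp u) * Complex.exp u with hG
  have hexp (u : ℂ) : Complex.exp u = ray u.im (Real.exp u.re) := by
    rw [← exp_add_mul_I_eq_ray, Complex.re_add_im]
  have hrect (R : ℝ) (hR : 0 ≤ R) : (∫ x : ℝ in -R..R, G (x + a * Complex.I)) -
      (∫ x : ℝ in -R..R, G (x + b * Complex.I)) =
      Complex.I • (∫ y : ℝ in a..b, G ((-R : ℝ) + y * Complex.I)) -
      Complex.I • (∫ y : ℝ in a..b, G (R + y * Complex.I)) := by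
    have := Complex.integral_boundary_rect_eq_zero_of_continuousOn_of_differentiableOn G
      ((-R : ℝ) + a * Complex.I) (R + b * Complex.I) ?_ ?_
    · simp only [Complex.add_re, Complex.ofReal_re, Complex.mul_re, Complex.I_re, mul_zero,
        Complex.ofReal_im, Complex.I_im, mul_one, sub_self, add_zero, Complex.add_im,
        Complex.mul_im, zero_add] at this
      linear_combination this
    · refine ContinuousOn.mul (hg.comp Complex.continuous_exp.continuousOn fun u hu => ?_)
        Complex.continuous_exp.continuousOn
      rw [hexp]
      have := hu.2
      simp only [Complex.add_im, Complex.ofReal_im, Complex.mul_im, Complex.ofReal_re,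
        Complex.I_im, mul_one, Complex.I_re, mul_zero, add_zero, zero_add, mem_preimage,
        uIcc_of_le hab] at this
      exact ray_mem_sector this (Real.exp_pos _)
    · intro u hu
      have := hu.2
      simp only [Complex.add_im, Complex.ofReal_im, Complex.mul_im, Complex.ofReal_re,
        Complex.I_im, mul_one, Complex.I_re, mul_zero, add_zero, zero_add, mem_preimage,
        min_eq_left hab, max_eq_right hab] at this
      have h := hd _ this _ (Real.exp_pos u.re)
      rw [← hexp] at h
      exact ((h.comp u Complex.differentiable_exp.differentiableAt).mul
        Complex.differentiable_exp.differentiableAt).differentiableWithinAt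
  -- This one bound kills both vertical edges: the decay of `g` at `+∞`, the Jacobian `e^x` at `-∞`.
  have hside (x : ℝ) : ‖∫ y : ℝ in a..b, G (x + y * Complex.I)‖ ≤
      C * Real.exp (-c * Real.exp x) * Real.exp x * |b - a| := by
    refine intervalIntegral.norm_integral_le_of_norm_le_const fun y hy => ?_
    rw [uIoc_of_le hab] at hy
    simp only [hG]
    rw [norm_mul, exp_add_mul_I_eq_ray]
    have : ‖ray y (Real.exp x)‖ = Real.exp x := by
      rw [ray, norm_mul, norm_exp_I_mul, mul_one, Complex.norm_real, Real.norm_eq_abs,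
        Real.abs_exp]
    rw [this]
    exact mul_le_mul_of_nonneg_right (hb y ⟨hy.1.le, hy.2⟩ _ (Real.exp_pos x)) (Real.exp_pos x).le
  have hint (θ : ℝ) (hθ : θ ∈ Icc a b) :
      Integrable fun x : ℝ => G (x + θ * Complex.I) :=
    (rayIntegrable_iff_integrable_exp θ g).1 (rayIntegrable_of_norm_le hθ hc hg (hb θ hθ))
  have hlim (θ : ℝ) (hθ : θ ∈ Icc a b) :
      Tendsto (fun R : ℝ => ∫ x : ℝ in -R..R, G (x + θ * Complex.I)) atTop
        (𝓝 (rayIntegral θ g)) := by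
    rw [rayIntegral_eq_integral_exp]
    exact intervalIntegral_tendsto_integral (hint θ hθ) tendsto_neg_atTop_atBot tendsto_id
  have h1 : Tendsto (fun R : ℝ => ∫ y : ℝ in a..b, G (R + y * Complex.I)) atTop (𝓝 0) := by
    refine squeeze_zero_norm hside ?_
    simpa using ((tendsto_mul_exp_neg_mul_atTop hc C).comp Real.tendsto_exp_atTop).mul_const |b - a|
  have h2 : Tendsto (fun R : ℝ => ∫ y : ℝ in a..b, G ((-R : ℝ) + y * Complex.I)) atTop (𝓝 0) := by
    refine squeeze_zero_norm (fun R => hside (-R)) ?_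
    simpa using ((tendsto_mul_exp_neg_mul_zero c C).comp
      (Real.tendsto_exp_atBot.comp tendsto_neg_atTop_atBot)).mul_const |b - a|
  have h3 := (hlim a (left_mem_Icc.2 hab)).sub (hlim b (right_mem_Icc.2 hab))
  have h4 := (h2.const_smul Complex.I).sub (h1.const_smul Complex.I)
  rw [smul_zero, sub_zero] at h4
  refine sub_eq_zero.1 (tendsto_nhds_unique h3 (h4.congr' ?_))
  filter_upwards [eventually_ge_atTop 0] with R hR
  exact (hrect R hR).symm

/-! ### The inner integral `φ`: convergence, continuity, analyticity -/

lemma ray_pow (θ t : ℝ) (k : ℕ) :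
    ray θ t ^ k = ((t ^ k : ℝ) : ℂ) * Complex.exp (Complex.I * ((k * θ : ℝ) : ℂ)) := by
  rw [ray, mul_pow, ← Complex.exp_nat_mul]
  push_cast
  congr 2
  ring

lemma exp_I_mul_re (θ : ℝ) : (Complex.exp (Complex.I * (θ : ℂ))).re = Real.cos θ := by
  rw [mul_comm, Complex.exp_ofReal_mul_I_re]

lemma exp_I_mul_im (θ : ℝ) : (Complex.exp (Complex.I * (θ : ℂ))).im = Real.sin θ := by
  rw [mul_comm, Complex.exp_ofReal_mul_I_im]

lemma ray_mul_exp_im (a r β : ℝ) :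
    (ray a r * Complex.exp (Complex.I * (β : ℂ))).im = r * Real.sin (a + β) := by
  rw [ray, mul_assoc, ← Complex.exp_add, Complex.im_ofReal_mul, ← mul_add, ← Complex.ofReal_add,
    exp_I_mul_im]

/-- The two terms of the exponent give the two conditions used throughout: a half-plane for `w`, and
`cos 2θ > 0` for Gaussian decay. -/
lemma norm_phiKernel (d : ℕ) (w : ℂ) (θ t : ℝ) :
    ‖phiKernel d w (ray θ t)‖ = Real.exp
      (-(t ^ d * (w * Complex.exp (Complex.I * ((d * θ : ℝ) : ℂ))).im) -
        t ^ 2 * Real.cos (2 * θ) / 2) := by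
  rw [phiKernel, Complex.norm_exp, ray_pow, ray_pow, Complex.sub_re]
  congr 2
  · rw [show Complex.I * w * (((t ^ d : ℝ) : ℂ) * Complex.exp (Complex.I * ((d * θ : ℝ) : ℂ))) =
      ((t ^ d : ℝ) : ℂ) * (Complex.I * (w * Complex.exp (Complex.I * ((d * θ : ℝ) : ℂ)))) by ring,
      Complex.re_ofReal_mul, Complex.I_mul_re]
    ring
  · rw [Complex.div_ofNat_re, Complex.re_ofReal_mul, exp_I_mul_re]
    norm_num

lemma norm_phiKernel_le {d : ℕ} {w : ℂ} {θ t c : ℝ} (ht : 0 < t)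
    (hw : 0 ≤ (w * Complex.exp (Complex.I * ((d * θ : ℝ) : ℂ))).im) (hc : c ≤ Real.cos (2 * θ)) :
    ‖phiKernel d w (ray θ t)‖ ≤ Real.exp (-(c / 2) * t ^ 2) := by
  rw [norm_phiKernel, Real.exp_le_exp]
  have h1 := mul_nonneg (pow_pos ht d).le hw
  have h2 := mul_le_mul_of_nonneg_left hc (sq_nonneg t)
  linarith

lemma continuous_rayIntegrand_phiKernel (d : ℕ) (θ : ℝ) (w : ℂ) :
    Continuous (rayIntegrand θ (phiKernel d w)) := by
  unfold rayIntegrand phiKernel ray; fun_prop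

/-- This is `(c/2)(t - 1/2)² ≥ 0`; it turns Gaussian decay into the exponential decay that the
rotation theorem asks for. -/
lemma exp_neg_mul_sq_le {c : ℝ} (hc : 0 < c) (t : ℝ) :
    Real.exp (-(c / 2) * t ^ 2) ≤ Real.exp (c / 8) * Real.exp (-(c / 2) * t) := by
  rw [← Real.exp_add, Real.exp_le_exp]
  nlinarith [mul_nonneg hc.le (sq_nonneg (t - 1 / 2))]

lemma integrableOn_exp_neg_mul_sq {c : ℝ} (hc : 0 < c) :
    IntegrableOn (fun t : ℝ => Real.exp (-(c / 2) * t ^ 2)) (Ioi 0) :=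
  (integrable_exp_neg_mul_sq (half_pos hc)).integrableOn

/-- The closed half-plane on which `φ_θ` converges. -/
def phiDomain (d : ℕ) (θ : ℝ) : Set ℂ :=
  {w | 0 ≤ (w * Complex.exp (Complex.I * ((d * θ : ℝ) : ℂ))).im}

lemma rayIntegrable_phiKernel {d : ℕ} {θ : ℝ} (hθ : 0 < Real.cos (2 * θ)) {w : ℂ}
    (hw : w ∈ phiDomain d θ) : RayIntegrable θ (phiKernel d w) := by
  refine (integrableOn_exp_neg_mul_sq hθ).mono'
    (continuous_rayIntegrand_phiKernel d θ w).aestronglyMeasurable ?_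
  filter_upwards [ae_restrict_mem measurableSet_Ioi] with t ht
  rw [norm_rayIntegrand]
  exact norm_phiKernel_le ht hw le_rfl

lemma exists_norm_phi_le (d : ℕ) {θ : ℝ} (hθ : 0 < Real.cos (2 * θ)) :
    ∃ M : ℝ, ∀ w ∈ phiDomain d θ, ‖phi d θ w‖ ≤ M := by
  refine ⟨‖1 / (Real.sqrt (2 * Real.pi) : ℂ)‖ *
    ∫ t in Ioi (0 : ℝ), Real.exp (-(Real.cos (2 * θ) / 2) * t ^ 2), fun w hw => ?_⟩
  rw [phi, norm_mul]
  refine mul_le_mul_of_nonneg_left ?_ (norm_nonneg _)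
  refine norm_integral_le_of_norm_le (integrableOn_exp_neg_mul_sq hθ) ?_
  filter_upwards [ae_restrict_mem measurableSet_Ioi] with t ht
  rw [norm_rayIntegrand]
  exact norm_phiKernel_le ht hw le_rfl

/-- The Gaussian majorant does not depend on `w`, so continuity reaches the boundary line of the
half-plane, where the real axis lies for `θ = 0`. -/
lemma continuousOn_phi (d : ℕ) {θ : ℝ} (hθ : 0 < Real.cos (2 * θ)) :
    ContinuousOn (phi d θ) (phiDomain d θ) := by
  unfold phi
  refine continuousOn_const.mul ?_
  refine continuousOn_of_dominated
    (fun w _ => (continuous_rayIntegrand_phiKernel d θ w).aestronglyMeasurable)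
    (fun w hw => ?_) (integrableOn_exp_neg_mul_sq hθ) ?_
  · filter_upwards [ae_restrict_mem measurableSet_Ioi] with t ht
    rw [norm_rayIntegrand]
    exact norm_phiKernel_le ht hw le_rfl
  · refine ae_of_all _ fun t => Continuous.continuousOn ?_
    unfold rayIntegrand phiKernel
    fun_prop

lemma differentiableAt_phi (d : ℕ) {θ : ℝ} (hθ : 0 < Real.cos (2 * θ)) {w : ℂ}
    (hw : 0 < (w * Complex.exp (Complex.I * ((d * θ : ℝ) : ℂ))).im) :
    DifferentiableAt ℂ (phi d θ) w := by
  unfold phi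
  refine DifferentiableAt.const_mul ?_ _
  have hopen : IsOpen {w : ℂ | 0 < (w * Complex.exp (Complex.I * ((d * θ : ℝ) : ℂ))).im} :=
    isOpen_lt continuous_const (by fun_prop)
  refine (hasDerivAt_integral_of_dominated_loc_of_deriv_le
    (F := fun w => rayIntegrand θ (phiKernel d w))
    (F' := fun w t => Complex.I * ray θ t ^ d * rayIntegrand θ (phiKernel d w) t)
    (bound := fun t => t ^ (d : ℝ) * Real.exp (-(Real.cos (2 * θ) / 2) * t ^ 2))
    (hopen.mem_nhds hw)
    (.of_forall fun w => (continuous_rayIntegrand_phiKernel d θ w).aestronglyMeasurable)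
    (rayIntegrable_phiKernel hθ (le_of_lt hw : w ∈ phiDomain d θ)) ?_ ?_
    (integrableOn_rpow_mul_exp_neg_mul_sq (half_pos hθ)
      (neg_one_lt_zero.trans_le d.cast_nonneg)) ?_).2.differentiableAt
  · refine Continuous.aestronglyMeasurable ?_
    exact (continuous_const.mul ((continuous_ray θ).pow d)).mul
      (continuous_rayIntegrand_phiKernel d θ w)
  · filter_upwards [ae_restrict_mem measurableSet_Ioi] with t ht v hv
    rw [norm_mul, norm_mul, Complex.norm_I, one_mul, norm_rayIntegrand, norm_pow, ray, norm_mul,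
      norm_exp_I_mul, mul_one, Complex.norm_real, Real.norm_of_nonneg (le_of_lt ht),
      Real.rpow_natCast]
    exact mul_le_mul_of_nonneg_left (norm_phiKernel_le ht (le_of_lt hv) le_rfl)
      (pow_nonneg (le_of_lt ht) d)
  · refine ae_of_all _ fun t v _ => ?_
    unfold rayIntegrand phiKernel
    have h : HasDerivAt (fun v : ℂ => Complex.I * v * ray θ t ^ d - ray θ t ^ 2 / 2)
        (Complex.I * 1 * ray θ t ^ d) v :=
      (((hasDerivAt_id v).const_mul Complex.I).mul_const _).sub_const _
    convert! h.cexp.mul_const (Complex.exp (Complex.I * (θ : ℂ))) using 1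
    ring

/-- Rotation of the contour defining `φ`. -/
lemma phi_eq_phi {d : ℕ} {a b c : ℝ} (hab : a ≤ b) (hc : 0 < c) {w : ℂ}
    (hcos : ∀ θ ∈ Icc a b, c ≤ Real.cos (2 * θ)) (hw : ∀ θ ∈ Icc a b, w ∈ phiDomain d θ) :
    phi d a w = phi d b w := by
  unfold phi
  congr 1
  have hdiff : Differentiable ℂ (phiKernel d w) := by unfold phiKernel; fun_prop
  exact rayIntegral_eq_rayIntegral hab (half_pos hc) hdiff.continuous.continuousOn
    (fun _ _ _ _ => hdiff _) fun θ hθ r hr =>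
      (norm_phiKernel_le hr (hw θ hθ) (hcos θ hθ)).trans (exp_neg_mul_sq_le hc r)

lemma ray_mem_phiDomain {d : ℕ} {θ a r : ℝ} (hr : 0 < r) (h : 0 ≤ Real.sin (a + d * θ)) :
    ray a r ∈ phiDomain d θ := by
  rw [phiDomain, Set.mem_ofPred_eq, ray_mul_exp_im]
  exact mul_nonneg hr.le h

/-! ### The outer integral `ψ` -/

lemma norm_psiKernel_ray (d n : ℕ) (z : ℂ) (θ θ' a r : ℝ) :
    ‖psiKernel d n z θ θ' (ray a r)‖ =
      Real.exp (r * (Complex.exp (Complex.I * (a : ℂ)) * z).im) *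
        ‖phi d θ (ray a r) - phi d θ' (ray a r)‖ ^ n := by
  rw [psiKernel, norm_mul, norm_pow, Complex.norm_exp, ray]
  congr 2
  rw [show -(Complex.I * (r * Complex.exp (Complex.I * (a : ℂ))) * z) =
    (r : ℂ) * -(Complex.I * (Complex.exp (Complex.I * (a : ℂ)) * z)) by ring,
    Complex.re_ofReal_mul, Complex.neg_re, Complex.I_mul_re, neg_neg]

lemma exists_norm_phi_sub_pow_le (d n : ℕ) {θ θ' : ℝ} (hθ : 0 < Real.cos (2 * θ))
    (hθ' : 0 < Real.cos (2 * θ')) :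
    ∃ C : ℝ, 0 ≤ C ∧ ∀ a r : ℝ, 0 < r → 0 ≤ Real.sin (a + d * θ) → 0 ≤ Real.sin (a + d * θ') →
      ‖phi d θ (ray a r) - phi d θ' (ray a r)‖ ^ n ≤ C := by
  obtain ⟨M, hM⟩ := exists_norm_phi_le d hθ
  obtain ⟨M', hM'⟩ := exists_norm_phi_le d hθ'
  refine ⟨|M + M'| ^ n, by positivity, fun a r hr h h' => ?_⟩
  refine pow_le_pow_left₀ (norm_nonneg _) ((norm_sub_le _ _).trans
    ((add_le_add (hM _ (ray_mem_phiDomain hr h)) (hM' _ (ray_mem_phiDomain hr h'))).trans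
      (le_abs_self _))) n

lemma sector_subset_phiDomain {d : ℕ} {θ a b : ℝ}
    (h : ∀ t ∈ Icc a b, 0 ≤ Real.sin (t + d * θ)) : sector a b ⊆ phiDomain d θ := by
  rintro _ ⟨t, ht, r, hr, rfl⟩
  exact ray_mem_phiDomain hr (h t ht)

lemma continuousOn_psiKernel {d : ℕ} (n : ℕ) {θ θ' a b : ℝ} (hθ : 0 < Real.cos (2 * θ))
    (hθ' : 0 < Real.cos (2 * θ')) (h : ∀ t ∈ Icc a b, 0 ≤ Real.sin (t + d * θ))
    (h' : ∀ t ∈ Icc a b, 0 ≤ Real.sin (t + d * θ')) (z : ℂ) :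
    ContinuousOn (psiKernel d n z θ θ') (sector a b) := by
  unfold psiKernel
  refine ContinuousOn.mul (Continuous.continuousOn (by fun_prop)) (ContinuousOn.pow ?_ n)
  exact ((continuousOn_phi d hθ).mono (sector_subset_phiDomain h)).sub
    ((continuousOn_phi d hθ').mono (sector_subset_phiDomain h'))

/-- Rotation of the contour defining `ψ`. -/
lemma psi_eq_psi {d : ℕ} (n : ℕ) {θ θ' a b : ℝ} (hab : a ≤ b) (hθ : 0 < Real.cos (2 * θ))
    (hθ' : 0 < Real.cos (2 * θ')) (h : ∀ t ∈ Icc a b, 0 ≤ Real.sin (t + d * θ))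
    (h' : ∀ t ∈ Icc a b, 0 ≤ Real.sin (t + d * θ'))
    (ho : ∀ t ∈ Ioo a b, 0 < Real.sin (t + d * θ))
    (ho' : ∀ t ∈ Ioo a b, 0 < Real.sin (t + d * θ')) {z : ℂ}
    (hz : ∀ t ∈ Icc a b, (Complex.exp (Complex.I * (t : ℂ)) * z).im < 0) :
    psi d n z θ θ' a = psi d n z θ θ' b := by
  obtain ⟨C, hC, hb⟩ := exists_norm_phi_sub_pow_le d n hθ hθ'
  -- The worst angle `t₀` supplies one decay rate for the whole sector.
  obtain ⟨t₀, ht₀, hmax⟩ := isCompact_Icc.exists_isMaxOn (nonempty_Icc.2 hab)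
    (f := fun t : ℝ => (Complex.exp (Complex.I * (t : ℂ)) * z).im)
    (Continuous.continuousOn (by fun_prop))
  refine rayIntegral_eq_rayIntegral (C := C) hab (neg_pos.2 (hz t₀ ht₀))
    (continuousOn_psiKernel n hθ hθ' h h' z) (fun t ht r hr => ?_) fun t ht r hr => ?_
  · unfold psiKernel
    refine DifferentiableAt.mul (by fun_prop) (DifferentiableAt.pow (DifferentiableAt.sub ?_ ?_) n)
    · refine differentiableAt_phi d hθ ?_
      rw [ray_mul_exp_im]
      exact mul_pos hr (ho t ht)
    · refine differentiableAt_phi d hθ' ?_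
      rw [ray_mul_exp_im]
      exact mul_pos hr (ho' t ht)
  · rw [norm_psiKernel_ray, mul_comm]
    refine mul_le_mul (hb t r hr (h t ht) (h' t ht)) ?_ (Real.exp_pos _).le hC
    rw [Real.exp_le_exp, neg_neg, mul_comm r]
    exact mul_le_mul_of_nonneg_right (hmax ht) hr.le

lemma rayIntegrable_psiKernel {d : ℕ} (n : ℕ) {θ θ' α : ℝ} (hθ : 0 < Real.cos (2 * θ))
    (hθ' : 0 < Real.cos (2 * θ')) (h : 0 ≤ Real.sin (α + d * θ))
    (h' : 0 ≤ Real.sin (α + d * θ')) {z : ℂ}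
    (hz : (Complex.exp (Complex.I * (α : ℂ)) * z).im < 0) :
    RayIntegrable α (psiKernel d n z θ θ') := by
  obtain ⟨C, hC, hb⟩ := exists_norm_phi_sub_pow_le d n hθ hθ'
  refine rayIntegrable_of_norm_le (a := α) (b := α) (C := C) ⟨le_rfl, le_rfl⟩ (neg_pos.2 hz)
    (continuousOn_psiKernel n hθ hθ' (by simpa using h) (by simpa using h') z) fun r hr => ?_
  rw [norm_psiKernel_ray, mul_comm, neg_neg, mul_comm r]
  exact mul_le_mul_of_nonneg_right (hb α r hr h h') (Real.exp_pos _).le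

lemma psiConverges {d : ℕ} (n : ℕ) {θ θ' α : ℝ} (hθ : 0 < Real.cos (2 * θ))
    (hθ' : 0 < Real.cos (2 * θ')) (h : 0 ≤ Real.sin (α + d * θ))
    (h' : 0 ≤ Real.sin (α + d * θ')) {z : ℂ}
    (hz : (Complex.exp (Complex.I * (α : ℂ)) * z).im < 0) : PsiConverges d n z θ θ' α :=
  ⟨fun _ ht => ⟨rayIntegrable_phiKernel hθ (ray_mem_phiDomain ht h),
    rayIntegrable_phiKernel hθ' (ray_mem_phiDomain ht h')⟩,
    rayIntegrable_psiKernel n hθ hθ' h h' hz⟩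

/-- Any `c` strictly between `Im (e^{iα} z)` and `0` gives a majorant valid near `z`. On a suitably
turned ray this includes real `z`, so the damping can be removed. -/
lemma continuousAt_psi {d : ℕ} (n : ℕ) {θ θ' α : ℝ} (hθ : 0 < Real.cos (2 * θ))
    (hθ' : 0 < Real.cos (2 * θ')) (h : 0 ≤ Real.sin (α + d * θ))
    (h' : 0 ≤ Real.sin (α + d * θ')) {z : ℂ}
    (hz : (Complex.exp (Complex.I * (α : ℂ)) * z).im < 0) :
    ContinuousAt (fun z => psi d n z θ θ' α) z := by
  obtain ⟨C, hC, hb⟩ := exists_norm_phi_sub_pow_le d n hθ hθ'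
  obtain ⟨c, hzc, hc⟩ := exists_between hz
  have hcont : Continuous fun z : ℂ => (Complex.exp (Complex.I * (α : ℂ)) * z).im := by fun_prop
  refine continuousAt_of_dominated (bound := fun r => C * Real.exp (-(-c) * r))
    (.of_forall fun z => ?_) ?_ (integrableOn_const_mul_exp_neg (neg_pos.2 hc) C)
    (ae_of_all _ fun r => Continuous.continuousAt ?_)
  · exact (continuousOn_rayIntegrand (a := α) (b := α) ⟨le_rfl, le_rfl⟩ (continuousOn_psiKernel n
      hθ hθ' (by simpa using h) (by simpa using h') z)).aestronglyMeasurable measurableSet_Ioi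
  · filter_upwards [hcont.continuousAt.eventually_lt_const hzc] with z hz
    filter_upwards [ae_restrict_mem measurableSet_Ioi] with r hr
    rw [norm_rayIntegrand, norm_psiKernel_ray, mul_comm, neg_neg, mul_comm r]
    refine mul_le_mul (hb α r hr h h') ?_ (Real.exp_pos _).le hC
    rw [Real.exp_le_exp]
    exact mul_le_mul_of_nonneg_right hz.le (le_of_lt hr)
  · unfold rayIntegrand psiKernel
    fun_prop

/-! ### Poisson integrals and Stieltjes inversion -/

lemma norm_exp_damped (δ s t x y : ℝ) :
    ‖Complex.exp (-(δ + s * x * Complex.I) * t) * Complex.exp (((s * t : ℝ) : ℂ) * y * Complex.I)‖ =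
      Real.exp (-δ * t) := by
  rw [← Complex.exp_add, Complex.norm_exp]
  simp

/-- The Laplace–Fourier transform of a characteristic function on a half-line. -/
lemma integral_exp_mul_charFun (μ : Measure ℝ) [IsFiniteMeasure μ] {δ : ℝ} (hδ : 0 < δ)
    (s x : ℝ) :
    ∫ t in Ioi (0 : ℝ), Complex.exp (-(δ + s * x * Complex.I) * t) * charFun μ (s * t) =
      ∫ y, 1 / (δ + s * (x - y) * Complex.I : ℂ) ∂μ := by
  have hint : Integrable (Function.uncurry fun t y : ℝ =>
      Complex.exp (-(δ + s * x * Complex.I) * t) *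
        Complex.exp (((s * t : ℝ) : ℂ) * y * Complex.I))
      ((volume.restrict (Ioi (0 : ℝ))).prod μ) := by
    have h := Integrable.mul_prod (ν := μ) (integrableOn_exp_mul_Ioi (neg_lt_zero.2 hδ) 0)
      (integrable_const (1 : ℝ))
    refine h.mono' (Continuous.aestronglyMeasurable (by unfold Function.uncurry; fun_prop))
      (ae_of_all _ fun p => ?_)
    rw [Function.uncurry, norm_exp_damped, mul_one]
  simp_rw [charFun_apply_real, ← integral_const_mul]
  rw [integral_integral_swap hint]
  refine integral_congr_ae (ae_of_all _ fun y => ?_)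
  have hre : (-(δ + s * (x - y) * Complex.I) : ℂ).re < 0 := by simpa using hδ
  have h := integral_exp_mul_complex_Ioi hre 0
  simp only [Complex.ofReal_zero, mul_zero, Complex.exp_zero, neg_div_neg_eq] at h
  refine Eq.trans (integral_congr_ae (ae_of_all _ fun t => ?_)) h
  simp only
  rw [← Complex.exp_add]
  push_cast
  congr 1
  ring

lemma add_mul_I_ne_zero {δ : ℝ} (hδ : 0 < δ) (u : ℝ) : (δ + u * Complex.I : ℂ) ≠ 0 := by
  intro h
  have := congrArg Complex.re h
  simp at this
  exact hδ.ne' this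

lemma integrable_one_div_add_mul_I (μ : Measure ℝ) [IsFiniteMeasure μ] {δ : ℝ} (hδ : 0 < δ)
    (s x : ℝ) : Integrable (fun y : ℝ => 1 / (δ + s * (x - y) * Complex.I : ℂ)) μ := by
  have hne (y : ℝ) : (δ + s * (x - y) * Complex.I : ℂ) ≠ 0 := by
    simpa using add_mul_I_ne_zero hδ (s * (x - y))
  refine (integrable_const (1 / δ)).mono' (Continuous.aestronglyMeasurable ?_)
    (ae_of_all _ fun y => ?_)
  · exact continuous_const.div (by fun_prop) hne
  · rw [norm_div, norm_one]
    refine one_div_le_one_div_of_le hδ ((le_abs_self δ).trans ?_)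
    simpa using Complex.abs_re_le_norm (δ + s * (x - y) * Complex.I : ℂ)

/-- The two damped half-line Fourier integrals of a characteristic function add up to the Poisson
integral of the measure. -/
lemma integral_exp_mul_charFun_add (μ : Measure ℝ) [IsFiniteMeasure μ] {δ : ℝ} (hδ : 0 < δ)
    (x : ℝ) :
    (∫ t in Ioi (0 : ℝ), Complex.exp (-(δ + x * Complex.I) * t) * charFun μ t) +
      (∫ t in Ioi (0 : ℝ), Complex.exp (-(δ - x * Complex.I) * t) * charFun μ (-t)) =
      ((∫ y, 2 * (δ / (δ ^ 2 + (x - y) ^ 2)) ∂μ : ℝ) : ℂ) := by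
  have h1 := integral_exp_mul_charFun μ hδ 1 x
  have h2 := integral_exp_mul_charFun μ hδ (-1) x
  simp only [Complex.ofReal_one, one_mul, Complex.ofReal_neg, neg_mul, ← sub_eq_add_neg] at h1 h2
  simp only [neg_mul]
  rw [h1, h2, ← integral_add (by simpa using integrable_one_div_add_mul_I μ hδ 1 x)
    (by simpa only [Complex.ofReal_neg, Complex.ofReal_one, neg_mul, one_mul,
      ← sub_eq_add_neg] using integrable_one_div_add_mul_I μ hδ (-1) x),
    ← integral_complex_ofReal]
  refine integral_congr_ae (ae_of_all _ fun y => ?_)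
  -- With `u = x - y`, this is `1/(δ + iu) + 1/(δ - iu) = 2δ/(δ² + u²)`.
  have hp := add_mul_I_ne_zero hδ (x - y)
  have hm := add_mul_I_ne_zero hδ (-(x - y))
  have hd : (δ : ℂ) ^ 2 + (x - y) ^ 2 = (δ + (x - y) * Complex.I) * (δ - (x - y) * Complex.I) := by
    linear_combination ((x - y : ℂ) ^ 2) * Complex.I_sq
  push_cast at hp hm ⊢
  rw [neg_mul, ← sub_eq_add_neg] at hm
  rw [hd]
  field_simp
  ring

lemma hasDerivAt_arctan_sub_div {δ : ℝ} (hδ : 0 < δ) (y x : ℝ) :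
    HasDerivAt (fun x => Real.arctan ((x - y) / δ)) (δ / (δ ^ 2 + (x - y) ^ 2)) x := by
  have h := (((hasDerivAt_id x).sub_const y).div_const δ).arctan
  convert! h using 1
  have : δ ^ 2 + (x - y) ^ 2 ≠ 0 := by positivity
  simp only [id]
  field_simp

lemma continuous_poisson {δ : ℝ} (hδ : 0 < δ) :
    Continuous fun p : ℝ × ℝ => 2 * (δ / (δ ^ 2 + (p.1 - p.2) ^ 2)) :=
  continuous_const.mul (continuous_const.div (by fun_prop) fun p => by positivity)

lemma integral_integral_poisson (μ : Measure ℝ) [IsFiniteMeasure μ] {δ : ℝ} (hδ : 0 < δ)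
    (a b : ℝ) :
    ∫ x in a..b, ∫ y, 2 * (δ / (δ ^ 2 + (x - y) ^ 2)) ∂μ =
      2 * ∫ y, (Real.arctan ((b - y) / δ) - Real.arctan ((a - y) / δ)) ∂μ := by
  have : IsFiniteMeasure (volume.restrict (uIoc a b)) :=
    ⟨by rw [Measure.restrict_apply_univ, uIoc]; exact measure_Ioc_lt_top⟩
  rw [intervalIntegral_integral_swap, ← integral_const_mul]
  · refine integral_congr_ae (ae_of_all _ fun y => ?_)
    simp only
    rw [intervalIntegral.integral_const_mul]
    congr 1
    refine intervalIntegral.integral_eq_sub_of_hasDerivAt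
      (fun x _ => hasDerivAt_arctan_sub_div hδ y x) (Continuous.intervalIntegrable ?_ _ _)
    exact continuous_const.div (by fun_prop) fun p => by positivity
  · refine (integrable_const (2 * (1 / δ))).mono' (continuous_poisson hδ).aestronglyMeasurable
      (ae_of_all _ fun p => ?_)
    have h2 : δ / (δ ^ 2 + (p.1 - p.2) ^ 2) ≤ 1 / δ := by
      rw [div_le_div_iff₀ (by positivity) hδ]
      nlinarith [sq_nonneg (p.1 - p.2)]
    rw [Function.uncurry, Real.norm_of_nonneg (by positivity)]
    linarith

lemma tendsto_arctan_div_nhdsGT (u : ℝ) (hu : u ≠ 0) :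
    Tendsto (fun δ : ℝ => Real.arctan (u / δ)) (𝓝[>] 0)
      (𝓝 (if 0 < u then Real.pi / 2 else -(Real.pi / 2))) := by
  rcases hu.lt_or_gt with h | h
  · rw [if_neg h.not_gt]
    exact (Real.tendsto_arctan_atBot.mono_right nhdsWithin_le_nhds).comp
      (tendsto_inv_nhdsGT_zero.const_mul_atTop_of_neg h)
  · rw [if_pos h]
    exact (Real.tendsto_arctan_atTop.mono_right nhdsWithin_le_nhds).comp
      (tendsto_inv_nhdsGT_zero.const_mul_atTop h)

lemma integrable_arctan_sub_div (μ : Measure ℝ) [IsFiniteMeasure μ] (δ b : ℝ) :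
    Integrable (fun y => Real.arctan ((b - y) / δ)) μ := by
  refine (integrable_const (Real.pi / 2)).mono' (Measurable.aestronglyMeasurable (by fun_prop))
    (ae_of_all _ fun y => ?_)
  exact abs_le.2 ⟨(Real.neg_pi_div_two_lt_arctan _).le, (Real.arctan_lt_pi_div_two _).le⟩

/-- The integrand tends to `π · 1_{y < b} - π/2` except at `y = b`, which is null because `μ` has no
atoms. -/
lemma tendsto_integral_arctan (μ : Measure ℝ) [IsProbabilityMeasure μ] [NullSingletonClass μ] (b : ℝ) :
    Tendsto (fun δ : ℝ => ∫ y, Real.arctan ((b - y) / δ) ∂μ) (𝓝[>] 0)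
      (𝓝 (Real.pi * μ.real (Iio b) - Real.pi / 2)) := by
  have hlim : ∫ y, ((Iio b).indicator (fun _ => Real.pi) y - Real.pi / 2) ∂μ =
      Real.pi * μ.real (Iio b) - Real.pi / 2 := by
    rw [integral_sub ((integrable_const _).indicator measurableSet_Iio) (integrable_const _),
      integral_indicator_const _ measurableSet_Iio, integral_const, probReal_univ, one_smul,
      smul_eq_mul, mul_comm]
  rw [← hlim]
  refine tendsto_integral_filter_of_dominated_convergence (fun _ => Real.pi / 2)
    (.of_forall fun δ => (integrable_arctan_sub_div μ δ b).aestronglyMeasurable)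
    (.of_forall fun δ => ae_of_all _ fun y =>
      abs_le.2 ⟨(Real.neg_pi_div_two_lt_arctan _).le, (Real.arctan_lt_pi_div_two _).le⟩)
    (integrable_const _) ?_
  filter_upwards [compl_mem_ae_iff.2 (measure_singleton (μ := μ) b)] with y hy
  have hne : b - y ≠ 0 := sub_ne_zero.2 fun h => hy h.symm
  convert! tendsto_arctan_div_nhdsGT (b - y) hne using 2
  by_cases h : y < b
  · rw [indicator_of_mem (by exact h), if_pos (sub_pos.2 h)]
    ring
  · rw [indicator_of_notMem (by exact h), if_neg (by linarith)]
    ring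

/-- Stieltjes inversion: if the Poisson integrals of `μ` extend continuously to the boundary over
`[a, b]`, the boundary values integrate to the mass of `[a, b]`. -/
lemma integral_boundary_values (μ : Measure ℝ) [IsProbabilityMeasure μ] [NullSingletonClass μ] {a b : ℝ}
    {A : ℝ → ℝ → ℂ}
    (hA : ContinuousOn (Function.uncurry A) (Icc (0 : ℝ) 1 ×ˢ uIcc a b))
    (hP : ∀ δ ∈ Ioc (0 : ℝ) 1, ∀ x ∈ uIcc a b,
      A δ x = ((∫ y, 2 * (δ / (δ ^ 2 + (x - y) ^ 2)) ∂μ : ℝ) : ℂ)) :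
    ∫ x in a..b, A 0 x = ((2 * Real.pi * (μ.real (Iio b) - μ.real (Iio a)) : ℝ) : ℂ) := by
  have hmem : ∀ᶠ δ : ℝ in 𝓝[>] 0, δ ∈ Ioc (0 : ℝ) 1 :=
    Ioc_mem_nhdsGT one_pos
  obtain ⟨M, hM⟩ := (isCompact_Icc.prod isCompact_uIcc).exists_bound_of_continuousOn hA
  have hslice (δ : ℝ) (hδ : δ ∈ Icc (0 : ℝ) 1) : ContinuousOn (A δ) (uIcc a b) :=
    hA.comp (f := fun x => (δ, x)) (by fun_prop) fun x hx => ⟨hδ, hx⟩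
  have h1 : Tendsto (fun δ : ℝ => ∫ x in a..b, A δ x) (𝓝[>] 0) (𝓝 (∫ x in a..b, A 0 x)) := by
    refine intervalIntegral.tendsto_integral_filter_of_dominated_convergence (fun _ => M) ?_ ?_
      intervalIntegrable_const ?_
    · filter_upwards [hmem] with δ hδ
      exact ((hslice δ ⟨hδ.1.le, hδ.2⟩).mono uIoc_subset_uIcc).aestronglyMeasurable
        measurableSet_uIoc
    · filter_upwards [hmem] with δ hδ
      exact ae_of_all _ fun x hx => hM (δ, x) ⟨⟨hδ.1.le, hδ.2⟩, uIoc_subset_uIcc hx⟩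
    · refine ae_of_all _ fun x hx => ?_
      have hx' := uIoc_subset_uIcc hx
      have h := (hA (0, x) ⟨⟨le_rfl, zero_le_one⟩, hx'⟩).tendsto
      refine h.comp (f := fun δ : ℝ => (δ, x)) (tendsto_nhdsWithin_iff.2 ⟨?_, ?_⟩)
      · exact ((continuous_id.prodMk continuous_const).tendsto (0 : ℝ)).mono_left
          nhdsWithin_le_nhds
      · filter_upwards [hmem] with δ hδ
        exact ⟨⟨hδ.1.le, hδ.2⟩, hx'⟩
  have h2 : Tendsto (fun δ : ℝ => ((2 * ∫ y, (Real.arctan ((b - y) / δ) -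
      Real.arctan ((a - y) / δ)) ∂μ : ℝ) : ℂ)) (𝓝[>] 0)
      (𝓝 ((2 * Real.pi * (μ.real (Iio b) - μ.real (Iio a)) : ℝ) : ℂ)) := by
    refine (Complex.continuous_ofReal.tendsto _).comp ?_
    have h := ((tendsto_integral_arctan μ b).sub (tendsto_integral_arctan μ a)).const_mul 2
    convert! h using 2
    · rw [integral_sub (integrable_arctan_sub_div μ _ b) (integrable_arctan_sub_div μ _ a)]
    · ring
  refine tendsto_nhds_unique h1 (h2.congr' ?_)
  filter_upwards [hmem] with δ hδ
  rw [← integral_integral_poisson μ hδ.1, ← intervalIntegral.integral_ofReal]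
  exact (intervalIntegral.integral_congr fun x hx => hP δ hδ x hx).symm

/-- A real function whose increments are the integrals of a continuous complex function. -/
lemma hasDerivAt_of_integral_eq {F : ℝ → ℝ} {g : ℝ → ℂ} {U : Set ℝ} (hU : IsOpen U) {x : ℝ}
    (hx : x ∈ U) (hg : ContinuousOn g U)
    (hF : ∀ u ∈ U, ∫ t in x..u, g t = ((F u - F x : ℝ) : ℂ)) :
    HasDerivAt F (g x).re x ∧ ((g x).re : ℂ) = g x := by
  have h : HasDerivAt (fun u => ((F u - F x : ℝ) : ℂ)) (g x) x := by
    have := intervalIntegral.integral_hasDerivAt_right (a := x) (b := x)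
      (by simp) (hg.stronglyMeasurableAtFilter hU x hx) (hg.continuousAt (hU.mem_nhds hx))
    refine this.congr_of_eventuallyEq ?_
    filter_upwards [hU.mem_nhds hx] with u hu
    exact (hF u hu).symm
  have hre := Complex.reCLM.hasFDerivAt.comp_hasDerivAt x h
  have him := Complex.imCLM.hasFDerivAt.comp_hasDerivAt x h
  constructor
  · simpa [Function.comp_def] using hre.add_const (F x)
  -- The increments are real, so the imaginary part of the derivative vanishes.
  · have h0 : (g x).im = 0 := by
      refine him.unique ?_
      simpa [Function.comp_def] using hasDerivAt_const x (0 : ℝ)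
    exact Complex.ext (by simp) (by simp [h0])

/-! ### The characteristic function on the real axis -/

lemma ray_zero (t : ℝ) : ray 0 t = t := by simp [ray]

lemma exp_I_mul_pi : Complex.exp (Complex.I * (Real.pi : ℂ)) = -1 := by
  rw [mul_comm, Complex.exp_pi_mul_I]

lemma ray_pi (t : ℝ) : ray Real.pi t = ((-t : ℝ) : ℂ) := by
  rw [ray, exp_I_mul_pi]
  simp

lemma rayIntegral_zero (g : ℂ → ℂ) : rayIntegral 0 g = ∫ t in Ioi (0 : ℝ), g t := by
  simp [rayIntegral, rayIntegrand, ray_zero]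

lemma rayIntegral_pi (g : ℂ → ℂ) :
    rayIntegral Real.pi g = -∫ t in Ioi (0 : ℝ), g ((-t : ℝ) : ℂ) := by
  simp_rw [rayIntegral, rayIntegrand, ray_pi, exp_I_mul_pi, mul_neg_one]
  exact integral_neg _

lemma norm_phiKernel_ofReal (d : ℕ) (t x : ℝ) :
    ‖phiKernel d t x‖ = Real.exp (-(1 / 2) * x ^ 2) := by
  have : Complex.I * t * (x : ℂ) ^ d - (x : ℂ) ^ 2 / 2 =
      ((-(1 / 2) * x ^ 2 : ℝ) : ℂ) + ((t * x ^ d : ℝ) : ℂ) * Complex.I := by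
    push_cast
    ring
  rw [phiKernel, this, Complex.norm_exp, Complex.add_re, Complex.ofReal_re,
    Complex.re_ofReal_mul, Complex.I_re, mul_zero, add_zero]

lemma integrable_phiKernel_ofReal (d : ℕ) (t : ℝ) :
    Integrable fun x : ℝ => phiKernel d t x := by
  refine (integrable_exp_neg_mul_sq (by norm_num : (0 : ℝ) < 1 / 2)).mono'
    (Continuous.aestronglyMeasurable ?_) (ae_of_all _ fun x => (norm_phiKernel_ofReal d t x).le)
  unfold phiKernel
  fun_prop

/-- The characteristic function of the `d`-th power of a standard normal variable. -/
lemma charFun_map_pow_gaussianReal (d : ℕ) (t : ℝ) :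
    charFun ((gaussianReal 0 1).map fun x => x ^ d) t = phi d 0 t - phi d Real.pi t := by
  have hint := integrable_phiKernel_ofReal d t
  -- The ray of angle `π` runs from `0` to `-∞`, so `-φ_π` contributes the negative half-line and
  -- the difference is the full Gaussian integral.
  have hneg : ∫ x in Iic (0 : ℝ), phiKernel d t x =
      ∫ x in Ioi (0 : ℝ), phiKernel d t ((-x : ℝ) : ℂ) := by
    rw [integral_comp_neg_Ioi (0 : ℝ) fun x : ℝ => phiKernel d t x, neg_zero]
  rw [charFun_apply_real, integral_map (by fun_prop) (Continuous.aestronglyMeasurable (by fun_prop)),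
    integral_gaussianReal_eq_integral_smul one_ne_zero, phi, phi, rayIntegral_zero, rayIntegral_pi,
    ← hneg, ← mul_sub, sub_neg_eq_add, add_comm,
    intervalIntegral.integral_Iic_add_Ioi hint.integrableOn hint.integrableOn,
    ← integral_const_mul]
  refine integral_congr_ae (ae_of_all _ fun x => ?_)
  simp only [gaussianPDFReal, phiKernel, NNReal.coe_one, mul_one, sub_zero, Complex.real_smul,
    Complex.ofReal_mul, Complex.ofReal_inv, Complex.ofReal_exp, one_div]
  rw [mul_assoc, ← Complex.exp_add]
  push_cast
  congr 2
  ring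

/-! ### Absolute continuity of the law -/

/-- The inverse branch `y ↦ y^{1/d}` is differentiable on `(0, ∞)`, hence preserves null sets. -/
lemma volume_pow_preimage_inter_Ioi {d : ℕ} (hd : d ≠ 0) {s : Set ℝ} (hs : volume s = 0) :
    volume ({x : ℝ | x ^ d ∈ s} ∩ Ioi 0) = 0 := by
  refine measure_mono_null (t := (fun y : ℝ => y ^ ((d : ℝ)⁻¹)) '' (s ∩ Ioi 0)) ?_ ?_
  · rintro x ⟨hx, hx0⟩
    exact ⟨x ^ d, ⟨hx, mem_Ioi.2 (pow_pos hx0 d)⟩, Real.pow_rpow_inv_natCast (le_of_lt hx0) hd⟩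
  · refine addHaar_image_eq_zero_of_differentiableOn_of_addHaar_eq_zero volume (fun y hy => ?_)
      (measure_mono_null inter_subset_left hs)
    exact (Real.differentiableAt_rpow_const_of_ne _ hy.2.ne').differentiableWithinAt

lemma volume_pow_preimage {d : ℕ} (hd : d ≠ 0) {s : Set ℝ} (hs : volume s = 0) :
    volume {x : ℝ | x ^ d ∈ s} = 0 := by
  have hs' : volume ((fun x : ℝ => (-1) ^ d * x) ⁻¹' s) = 0 := by
    rw [Real.volume_preimage_mul_left (pow_ne_zero d (by norm_num)), hs, mul_zero]
  have h2 : volume (-({x : ℝ | x ^ d ∈ (fun x : ℝ => (-1) ^ d * x) ⁻¹' s} ∩ Ioi 0)) = 0 := by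
    rw [Measure.measure_neg]
    exact volume_pow_preimage_inter_Ioi hd hs'
  refine measure_mono_null (fun x hx => ?_) (measure_union_null
    (measure_union_null (volume_pow_preimage_inter_Ioi hd hs) h2) (measure_singleton (0 : ℝ)))
  rcases lt_trichotomy x 0 with h | h | h
  · refine Or.inl (Or.inr ⟨?_, neg_pos.2 h⟩)
    change (-1) ^ d * (-x) ^ d ∈ s
    rw [← mul_pow, neg_one_mul, neg_neg]
    exact hx
  · exact Or.inr h
  · exact Or.inl (Or.inl ⟨hx, h⟩)

lemma map_pow_gaussianReal_absolutelyContinuous {d : ℕ} (hd : d ≠ 0) :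
    (gaussianReal 0 1).map (fun x => x ^ d) ≪ volume := by
  refine Measure.AbsolutelyContinuous.mk fun s hs h => ?_
  rw [Measure.map_apply (by fun_prop) hs]
  exact gaussianReal_absolutelyContinuous 0 one_ne_zero (volume_pow_preimage hd h)

section Sum

variable {Ω : Type*} [MeasurableSpace Ω] {P : Measure Ω} {n : ℕ}
  {X : Fin n → Ω → ℝ}

lemma map_pow_eq_map_gaussianReal {Y : Ω → ℝ} (hY : HasLaw Y (gaussianReal 0 1) P) (d : ℕ) :
    P.map (fun ω => Y ω ^ d) = (gaussianReal 0 1).map fun x => x ^ d := by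
  rw [← hY.map_eq, AEMeasurable.map_map_of_aemeasurable (by fun_prop) hY.aemeasurable]
  rfl

lemma iIndepFun_pow (hX : iIndepFun X P) (d : ℕ) : iIndepFun (fun k ω => X k ω ^ d) P :=
  hX.comp (fun _ x => x ^ d) fun _ => by fun_prop

lemma aemeasurable_sum_pow (hlaw : ∀ k, HasLaw (X k) (gaussianReal 0 1) P) (d : ℕ) :
    AEMeasurable (fun ω => ∑ k, X k ω ^ d) P :=
  Finset.aemeasurable_fun_sum _ fun k _ => (hlaw k).aemeasurable.pow_const d

lemma charFun_map_sum_pow (hlaw : ∀ k, HasLaw (X k) (gaussianReal 0 1) P) (hX : iIndepFun X P)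
    (d : ℕ) (t : ℝ) :
    charFun (P.map fun ω => ∑ k, X k ω ^ d) t = (phi d 0 t - phi d Real.pi t) ^ n := by
  rw [(iIndepFun_pow hX d).charFun_map_fun_sum_eq_prod
    (X := fun k ω => X k ω ^ d) fun k => (hlaw k).aemeasurable.pow_const d]
  simp [map_pow_eq_map_gaussianReal (hlaw _), charFun_map_pow_gaussianReal]

/-- One summand is split off, which needs `1 ≤ n`: convolving any law with an absolutely continuous
one gives an absolutely continuous one. -/
lemma map_sum_pow_absolutelyContinuous [IsProbabilityMeasure P]
    (hlaw : ∀ k, HasLaw (X k) (gaussianReal 0 1) P)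
    (hX : iIndepFun X P) {d : ℕ} (hd : d ≠ 0) (hn : 1 ≤ n) :
    (P.map fun ω => ∑ k, X k ω ^ d) ≪ volume := by
  have hm (k : Fin n) : AEMeasurable (fun ω => X k ω ^ d) P := (hlaw k).aemeasurable.pow_const d
  let i : Fin n := ⟨0, hn⟩
  have hind := (iIndepFun_pow hX d).indepFun_finsetSum_of_notMem₀ hm
    (Finset.notMem_erase i Finset.univ)
  have hsum : (fun ω => ∑ k, X k ω ^ d) =
      (∑ k ∈ Finset.univ.erase i, fun ω => X k ω ^ d) + fun ω => X i ω ^ d := by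
    ext ω
    simp
  rw [hsum, hind.map_add_eq_map_conv_map₀ (Finset.aemeasurable_sum _ fun k _ => hm k) (hm i)]
  refine Measure.conv_absolutelyContinuous ?_
  rw [map_pow_eq_map_gaussianReal (hlaw i)]
  exact map_pow_gaussianReal_absolutelyContinuous hd

end Sum

lemma nullSingletonClass_of_absolutelyContinuous {μ : Measure ℝ} (h : μ ≪ volume) :
    NullSingletonClass μ :=
  ⟨fun x => h (measure_singleton x)⟩

/-- An absolutely continuous law is the density of the derivative of its distribution function. -/
lemma eq_withDensity_of_hasDerivAt {μ : Measure ℝ} [IsProbabilityMeasure μ] (h : μ ≪ volume)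
    {f : ℝ → ℝ} (hf : ∀ x, x ≠ 0 → HasDerivAt (fun c => μ.real (Iio c)) (f x) x) :
    μ = volume.withDensity fun x => ENNReal.ofReal (f x) := by
  have := nullSingletonClass_of_absolutelyContinuous h
  conv_lhs => rw [← Measure.withDensity_rnDeriv_eq μ volume h]
  refine withDensity_congr_ae ?_
  -- By Lebesgue differentiation the distribution function has the Radon–Nikodym derivative as its
  -- derivative almost everywhere; uniqueness of derivatives identifies it with `f`.
  have hae := (cdf μ).ae_hasDerivAt
  rw [measure_cdf] at hae
  have hcdf : (cdf μ : ℝ → ℝ) = fun c => μ.real (Iio c) := by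
    ext c
    rw [cdf_eq_real, measureReal_congr Iio_ae_eq_Iic]
  rw [hcdf] at hae
  filter_upwards [hae, compl_mem_ae_iff.2 (measure_singleton (μ := volume) (0 : ℝ)),
    μ.rnDeriv_lt_top volume] with x hx h0 hlt
  rw [(hf x h0).unique hx, ENNReal.ofReal_toReal hlt.ne]

/-! ### Continuation to turned rays and passage to the boundary -/

/-- `w ↦ φ_θ(w)` continues `φ_{θ₀}` from the ray of angle `b` over the sector between the rays of
angles `b` and `α`. -/
structure IsContinuation (d : ℕ) (b α θ₀ θ : ℝ) : Prop where
  cos_pos : 0 < Real.cos (2 * θ)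
  sin_nonneg : ∀ t ∈ uIcc b α, 0 ≤ Real.sin (t + d * θ)
  sin_pos : ∀ t ∈ uIoo b α, 0 < Real.sin (t + d * θ)
  phi_eq : ∀ r : ℝ, 0 < r → phi d θ₀ (ray b r) = phi d θ (ray b r)

lemma exp_I_mul_mul_im (t x y : ℝ) :
    (Complex.exp (Complex.I * (t : ℂ)) * (x + y * Complex.I)).im =
      x * Real.sin t + y * Real.cos t := by
  rw [Complex.mul_im, exp_I_mul_re, exp_I_mul_im]
  simp
  ring

/-- On the initial outer ray the inner integrals can be exchanged, and afterwards the outer ray is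
turned. -/
lemma psi_eq_of_isContinuation {d : ℕ} (n : ℕ) {b α θ₀ θ₀' θ θ' : ℝ}
    (h : IsContinuation d b α θ₀ θ) (h' : IsContinuation d b α θ₀' θ') {z : ℂ}
    (hz : ∀ t ∈ uIcc b α, (Complex.exp (Complex.I * (t : ℂ)) * z).im < 0) :
    psi d n z θ₀ θ₀' b = psi d n z θ θ' α := by
  have h0 : psi d n z θ₀ θ₀' b = psi d n z θ θ' b := by
    refine setIntegral_congr_fun measurableSet_Ioi fun r hr => ?_
    simp only [rayIntegrand, psiKernel, h.phi_eq r hr, h'.phi_eq r hr]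
  rw [h0]
  rcases le_total b α with hle | hle
  · have h1 := h.sin_nonneg
    have h2 := h'.sin_nonneg
    have h3 := h.sin_pos
    have h4 := h'.sin_pos
    rw [uIcc_of_le hle] at h1 h2 hz
    rw [uIoo_of_le hle] at h3 h4
    exact psi_eq_psi n hle h.cos_pos h'.cos_pos h1 h2 h3 h4 hz
  · have h1 := h.sin_nonneg
    have h2 := h'.sin_nonneg
    have h3 := h.sin_pos
    have h4 := h'.sin_pos
    rw [uIcc_of_ge hle] at h1 h2 hz
    rw [uIoo_of_ge hle] at h3 h4
    exact (psi_eq_psi n hle h.cos_pos h'.cos_pos h1 h2 h3 h4 hz).symm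

/-- On this ray `w = t`, so lowering `z` to `x - iδ` produces the damping `e^{-δt}`; on the opposite
ray `z` has to be raised to `x + iδ`. -/
lemma psi_zero_eq_integral_charFun {d n : ℕ} {μ : Measure ℝ}
    (hμ : ∀ t : ℝ, charFun μ t = (phi d 0 t - phi d Real.pi t) ^ n) (x δ : ℝ) :
    psi d n (x + (-δ : ℝ) * Complex.I) 0 Real.pi 0 =
      ∫ t in Ioi (0 : ℝ), Complex.exp (-(δ + x * Complex.I) * t) * charFun μ t := by
  rw [psi, rayIntegral_zero]
  refine integral_congr_ae (ae_of_all _ fun t => ?_)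
  simp only [psiKernel, hμ]
  congr 2
  push_cast
  linear_combination (t * δ : ℂ) * Complex.I_sq

lemma psi_pi_eq_integral_charFun {d n : ℕ} {μ : Measure ℝ}
    (hμ : ∀ t : ℝ, charFun μ t = (phi d 0 t - phi d Real.pi t) ^ n) (x δ : ℝ) :
    psi d n (x + δ * Complex.I) 0 Real.pi Real.pi =
      -∫ t in Ioi (0 : ℝ), Complex.exp (-(δ - x * Complex.I) * t) * charFun μ (-t) := by
  rw [psi, rayIntegral_pi]
  congr 1
  refine integral_congr_ae (ae_of_all _ fun t => ?_)
  simp only [psiKernel, hμ]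
  congr 2
  push_cast
  linear_combination (t * δ : ℂ) * Complex.I_sq

/-- The derivative of the distribution function in terms of the rotated contour integrals. -/
lemma hasDerivAt_and_givenByContours {d n : ℕ} {μ : Measure ℝ} [IsProbabilityMeasure μ]
    [NullSingletonClass μ] (hμ : ∀ t : ℝ, charFun μ t = (phi d 0 t - phi d Real.pi t) ^ n)
    {α θ θ' β η η' : ℝ}
    (h₁ : IsContinuation d 0 α 0 θ) (h₁' : IsContinuation d 0 α Real.pi θ')
    (h₂ : IsContinuation d Real.pi β 0 η) (h₂' : IsContinuation d Real.pi β Real.pi η')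
    (hcos₁ : ∀ t ∈ uIcc 0 α, 0 < Real.cos t) (hcos₂ : ∀ t ∈ uIcc Real.pi β, Real.cos t < 0)
    {U : Set ℝ} (hU : IsOpen U) (hUc : U.OrdConnected)
    (hsin₁ : ∀ x ∈ U, ∀ t ∈ uIcc 0 α, x * Real.sin t ≤ 0)
    (hsin₂ : ∀ x ∈ U, ∀ t ∈ uIcc Real.pi β, x * Real.sin t ≤ 0)
    (hα : ∀ x ∈ U, x * Real.sin α < 0) (hβ : ∀ x ∈ U, x * Real.sin β < 0) {x : ℝ} (hx : x ∈ U) :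
    ∃ y : ℝ, HasDerivAt (fun c => μ.real (Iio c)) y x ∧
      GivenByContours d n x y θ θ' α η η' β := by
  have hα' : α ∈ uIcc 0 α := right_mem_uIcc
  have hβ' : β ∈ uIcc Real.pi β := right_mem_uIcc
  let A : ℝ → ℝ → ℂ := fun δ x =>
    psi d n (x + (-δ : ℝ) * Complex.I) θ θ' α - psi d n (x + δ * Complex.I) η η' β
  have him₁ : ∀ δ : ℝ, 0 ≤ δ → ∀ x ∈ U,
      (Complex.exp (Complex.I * (α : ℂ)) * (x + (-δ : ℝ) * Complex.I)).im < 0 := by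
    intro δ hδ x hx
    rw [exp_I_mul_mul_im]
    nlinarith [hα x hx, mul_nonneg hδ (hcos₁ α hα').le]
  have him₂ : ∀ δ : ℝ, 0 ≤ δ → ∀ x ∈ U,
      (Complex.exp (Complex.I * (β : ℂ)) * (x + δ * Complex.I)).im < 0 := by
    intro δ hδ x hx
    rw [exp_I_mul_mul_im]
    nlinarith [hβ x hx, mul_nonneg hδ (neg_pos.2 (hcos₂ β hβ')).le]
  have hAcont : ContinuousOn (Function.uncurry A) (Icc (0 : ℝ) 1 ×ˢ U) := by
    rintro ⟨δ, x⟩ ⟨hδ, hx⟩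
    refine ContinuousAt.continuousWithinAt (ContinuousAt.sub ?_ ?_)
    · exact ContinuousAt.comp_of_eq (f := fun p : ℝ × ℝ => (p.2 + (-p.1 : ℝ) * Complex.I : ℂ))
        (continuousAt_psi n h₁.cos_pos h₁'.cos_pos (h₁.sin_nonneg α hα') (h₁'.sin_nonneg α hα')
          (him₁ δ hδ.1 x hx)) (by fun_prop) rfl
    · exact ContinuousAt.comp_of_eq (f := fun p : ℝ × ℝ => (p.2 + p.1 * Complex.I : ℂ))
        (continuousAt_psi n h₂.cos_pos h₂'.cos_pos (h₂.sin_nonneg β hβ') (h₂'.sin_nonneg β hβ')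
          (him₂ δ hδ.1 x hx)) (by fun_prop) rfl
  -- Here `δ > 0` is essential: `x sin t` vanishes on the unturned rays, and only the `δ cos t` term
  -- keeps the exponential decaying along the whole rotation.
  have hAP : ∀ δ ∈ Ioc (0 : ℝ) 1, ∀ x ∈ U,
      A δ x = ((∫ y, 2 * (δ / (δ ^ 2 + (x - y) ^ 2)) ∂μ : ℝ) : ℂ) := by
    intro δ hδ x hx
    rw [← integral_exp_mul_charFun_add μ hδ.1, ← psi_zero_eq_integral_charFun hμ,
      ← neg_eq_iff_eq_neg.2 (psi_pi_eq_integral_charFun hμ x δ), ← sub_eq_add_neg,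
      psi_eq_of_isContinuation n h₁ h₁', psi_eq_of_isContinuation n h₂ h₂']
    · intro t ht
      rw [exp_I_mul_mul_im]
      nlinarith [hsin₂ x hx t ht, mul_pos hδ.1 (neg_pos.2 (hcos₂ t ht))]
    · intro t ht
      rw [exp_I_mul_mul_im]
      nlinarith [hsin₁ x hx t ht, mul_pos hδ.1 (hcos₁ t ht)]
  have hint : ∀ u ∈ U, ∫ t in x..u, 1 / (2 * Real.pi : ℂ) * A 0 t =
      ((μ.real (Iio u) - μ.real (Iio x) : ℝ) : ℂ) := by
    intro u hu
    have hsub : uIcc x u ⊆ U := hUc.uIcc_subset hx hu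
    rw [intervalIntegral.integral_const_mul, integral_boundary_values μ
      (hAcont.mono (prod_mono_right hsub)) fun δ hδ y hy => hAP δ hδ y (hsub hy)]
    have : (Real.pi : ℂ) ≠ 0 := Complex.ofReal_ne_zero.2 Real.pi_ne_zero
    push_cast
    field_simp
  have hA0 : ContinuousOn (fun t => 1 / (2 * Real.pi : ℂ) * A 0 t) U :=
    continuousOn_const.mul (hAcont.comp (f := fun t : ℝ => ((0 : ℝ), t)) (by fun_prop)
      fun t ht => ⟨⟨le_rfl, zero_le_one⟩, ht⟩)
  obtain ⟨hderiv, hreal⟩ := hasDerivAt_of_integral_eq (F := fun c => μ.real (Iio c)) hU hx hA0 hint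
  have e₁ := him₁ 0 le_rfl x hx
  have e₂ := him₂ 0 le_rfl x hx
  simp only [neg_zero, Complex.ofReal_zero, zero_mul, add_zero] at e₁ e₂
  refine ⟨_, hderiv,
    psiConverges n h₁.cos_pos h₁'.cos_pos (h₁.sin_nonneg α hα') (h₁'.sin_nonneg α hα') e₁,
    psiConverges n h₂.cos_pos h₂'.cos_pos (h₂.sin_nonneg β hβ') (h₂'.sin_nonneg β hβ') e₂, ?_⟩
  rw [hreal]
  simp [A]

lemma phi_ray_eq {d : ℕ} {b θ₀ θ c r : ℝ} (hr : 0 < r) (hc : 0 < c)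
    (hcos : ∀ η ∈ uIcc θ₀ θ, c ≤ Real.cos (2 * η))
    (hsin : ∀ η ∈ uIcc θ₀ θ, 0 ≤ Real.sin (b + d * η)) :
    phi d θ₀ (ray b r) = phi d θ (ray b r) := by
  rcases le_total θ₀ θ with h | h
  · rw [uIcc_of_le h] at hcos hsin
    exact phi_eq_phi h hc hcos fun η hη => ray_mem_phiDomain hr (hsin η hη)
  · rw [uIcc_of_ge h] at hcos hsin
    exact (phi_eq_phi h hc hcos fun η hη => ray_mem_phiDomain hr (hsin η hη)).symm

/-! ### The two kinds of continuation, with a sign `q` for the direction -/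

lemma sign_mul_sin_nonneg {q : ℝ} (hq : q = 1 ∨ q = -1) {u : ℝ} (h0 : 0 ≤ q * u)
    (h1 : q * u ≤ Real.pi) : 0 ≤ q * Real.sin u := by
  rcases hq with rfl | rfl
  · simpa using Real.sin_nonneg_of_nonneg_of_le_pi (by simpa using h0) (by simpa using h1)
  · simpa using Real.sin_nonneg_of_nonneg_of_le_pi h0 h1

lemma sign_mul_sin_pos {q : ℝ} (hq : q = 1 ∨ q = -1) {u : ℝ} (h0 : 0 < q * u)
    (h1 : q * u < Real.pi) : 0 < q * Real.sin u := by
  rcases hq with rfl | rfl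
  · simpa using Real.sin_pos_of_pos_of_lt_pi (by simpa using h0) (by simpa using h1)
  · simpa using Real.sin_pos_of_pos_of_lt_pi h0 h1

lemma sign_mul_mem_uIcc {q a c t : ℝ} (hq : q = 1 ∨ q = -1) (hc : 0 ≤ c)
    (ht : t ∈ uIcc a (a + q * c)) : 0 ≤ q * (t - a) ∧ q * (t - a) ≤ c := by
  rcases hq with rfl | rfl
  · rw [uIcc_of_le (by linarith)] at ht
    constructor <;> linarith [ht.1, ht.2]
  · rw [uIcc_of_ge (by linarith)] at ht
    constructor <;> linarith [ht.1, ht.2]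

lemma sign_mul_mem_uIoo {q a c t : ℝ} (hq : q = 1 ∨ q = -1) (hc : 0 ≤ c)
    (ht : t ∈ uIoo a (a + q * c)) : 0 < q * (t - a) ∧ q * (t - a) < c := by
  rcases hq with rfl | rfl
  · rw [uIoo_of_le (by linarith)] at ht
    constructor <;> linarith [ht.1, ht.2]
  · rw [uIoo_of_ge (by linarith)] at ht
    constructor <;> linarith [ht.1, ht.2]

/-- The outer ray turns into the half-plane where `φ_{θ₀}` already converges, so the inner ray stays
put. -/
lemma isContinuation_self {d : ℕ} {q b θ₀ β : ℝ} (hq : q = 1 ∨ q = -1)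
    (hsin : ∀ x : ℝ, Real.sin (x + b + d * θ₀) = q * Real.sin x)
    (hcos : 0 < Real.cos (2 * θ₀)) (hβ : 0 ≤ β) (hβπ : β ≤ Real.pi) :
    IsContinuation d b (b + q * β) θ₀ θ₀ where
  cos_pos := hcos
  sin_nonneg t ht := by
    have h := sign_mul_mem_uIcc hq hβ ht
    rw [← sub_add_cancel t b, hsin]
    exact sign_mul_sin_nonneg hq h.1 (h.2.trans hβπ)
  sin_pos t ht := by
    have h := sign_mul_mem_uIoo hq hβ ht
    rw [← sub_add_cancel t b, hsin]
    exact sign_mul_sin_pos hq h.1 (h.2.trans_le hβπ)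
  phi_eq _ _ := rfl

/-- The outer ray turns out of the half-plane of `φ_{θ₀}` by `εd`. Turning the inner ray by `ε` the
other way shifts `dθ` by exactly the amount that compensates. -/
lemma isContinuation_rotate {d : ℕ} {q b θ₀ ε : ℝ} (hq : q = 1 ∨ q = -1)
    (hsin : ∀ x : ℝ, Real.sin (x + b + d * θ₀) = q * Real.sin x)
    (hcos : ∀ x : ℝ, Real.cos (2 * (θ₀ + x)) = Real.cos (2 * x)) (hε : 0 ≤ ε)
    (hε4 : ε < Real.pi / 4) (hεd : ε * d ≤ Real.pi) :
    IsContinuation d b (b + -q * (ε * d)) θ₀ (θ₀ + q * ε) := by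
  have hqq : q * q = 1 := by rcases hq with rfl | rfl <;> norm_num
  have hq' : -q = 1 ∨ -q = -1 := by
    rcases hq with rfl | rfl
    · exact Or.inr rfl
    · exact Or.inl (neg_neg 1)
  have hβ : 0 ≤ ε * d := mul_nonneg hε d.cast_nonneg
  have hcosε : 0 < Real.cos (2 * ε) := Real.cos_pos_of_mem_Ioo ⟨by linarith, by linarith⟩
  have hsin' (t η : ℝ) : Real.sin (t + d * (θ₀ + η)) = q * Real.sin (t - b + d * η) := by
    rw [← hsin]
    congr 1
    ring
  have hcosq : Real.cos (2 * (θ₀ + q * ε)) = Real.cos (2 * ε) := by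
    rw [hcos]
    rcases hq with rfl | rfl
    · rw [one_mul]
    · rw [← Real.cos_neg]
      congr 1
      ring
  have hmul (t : ℝ) : q * (t - b + d * (q * ε)) = ε * d - -q * (t - b) := by
    linear_combination (d * ε : ℝ) * hqq
  refine ⟨hcosq ▸ hcosε, fun t ht => ?_, fun t ht => ?_, fun r hr => ?_⟩
  · have h := sign_mul_mem_uIcc hq' hβ ht
    rw [hsin']
    refine sign_mul_sin_nonneg hq ?_ ?_ <;> rw [hmul] <;> linarith
  · have h := sign_mul_mem_uIoo hq' hβ ht
    rw [hsin']
    refine sign_mul_sin_pos hq ?_ ?_ <;> rw [hmul] <;> linarith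
  · refine phi_ray_eq hr hcosε (fun η hη => ?_) fun η hη => ?_
    · have h := sign_mul_mem_uIcc hq hε hη
      have h2 : |2 * (η - θ₀)| ≤ 2 * ε := by
        rw [abs_le]
        rcases hq with rfl | rfl <;> constructor <;> linarith
      rw [← add_sub_cancel θ₀ η, hcos, ← Real.cos_abs (2 * (η - θ₀))]
      exact Real.cos_le_cos_of_nonneg_of_le_pi (abs_nonneg _) (by linarith) h2
    · have h := sign_mul_mem_uIcc hq hε hη
      rw [← add_sub_cancel θ₀ η, hsin', sub_self, zero_add]
      have hd : (0 : ℝ) ≤ d := d.cast_nonneg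
      refine sign_mul_sin_nonneg hq ?_ ?_ <;> rw [mul_left_comm, mul_comm]
      · exact mul_nonneg h.1 hd
      · exact (mul_le_mul_of_nonneg_right h.2 hd).trans hεd

section Parity

variable {d : ℕ}

lemma sin_add_odd_mul_pi (hd : Odd d) (x : ℝ) : Real.sin (x + d * Real.pi) = -Real.sin x := by
  rw [Real.sin_add_nat_mul_pi, hd.neg_one_pow, neg_one_mul]

lemma sin_add_even_mul_pi (hd : Even d) (x : ℝ) : Real.sin (x + d * Real.pi) = Real.sin x := by
  rw [Real.sin_add_nat_mul_pi, hd.neg_one_pow, one_mul]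

lemma cos_two_mul_pi_add (x : ℝ) : Real.cos (2 * (Real.pi + x)) = Real.cos (2 * x) := by
  rw [mul_add, add_comm, Real.cos_add_two_pi]

end Parity

/-! ### The four contour configurations -/

section Contours

variable {d n : ℕ} {μ : Measure ℝ} [IsProbabilityMeasure μ] [NullSingletonClass μ] {ε : ℝ}

/-- For `x > 0` decay of `e^{-iwx}` forces both outer rays into the lower half-plane, away from the
domain of `φ_0`; hence the angles `±ε`. The companion of `φ_π` depends on parity and is left as a
hypothesis. -/
lemma exists_hasDerivAt_of_pos (hμ : ∀ t : ℝ, charFun μ t = (phi d 0 t - phi d Real.pi t) ^ n)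
    (hd : 0 < d) (hε : 0 < ε) (hε4 : ε < Real.pi / 4) (hεd : ε * d < Real.pi / 4) {θ' η' : ℝ}
    (h₁' : IsContinuation d 0 (-(ε * d)) Real.pi θ')
    (h₂' : IsContinuation d Real.pi (Real.pi + ε * d) Real.pi η') {x : ℝ} (hx : 0 < x) :
    ∃ y : ℝ, HasDerivAt (fun c => μ.real (Iio c)) y x ∧
      GivenByContours d n x y ε θ' (-(ε * d)) (-ε) η' (Real.pi + ε * d) := by
  have hπ := Real.pi_pos
  have hβ : 0 < ε * d := mul_pos hε (Nat.cast_pos.2 hd)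
  have hβπ : ε * d ≤ Real.pi := by linarith
  have h₁ : IsContinuation d 0 (-(ε * d)) 0 ε := by
    simpa using isContinuation_rotate (d := d) (b := 0) (θ₀ := 0) (Or.inl rfl)
      (by simp) (by simp) hε.le hε4 hβπ
  have h₂ : IsContinuation d Real.pi (Real.pi + ε * d) 0 (-ε) := by
    simpa using isContinuation_rotate (d := d) (b := Real.pi) (θ₀ := 0) (Or.inr rfl)
      (by simp) (by simp) hε.le hε4 hβπ
  refine hasDerivAt_and_givenByContours hμ h₁ h₁' h₂ h₂' (fun t ht => ?_) (fun t ht => ?_)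
    isOpen_Ioi ordConnected_Ioi (fun x hx t ht => ?_) (fun x hx t ht => ?_) (fun x hx => ?_)
    (fun x hx => ?_) hx
  · rw [uIcc_of_ge (by linarith)] at ht
    exact Real.cos_pos_of_mem_Ioo ⟨by linarith [ht.1], by linarith [ht.2]⟩
  · rw [uIcc_of_le (by linarith)] at ht
    exact Real.cos_neg_of_pi_div_two_lt_of_lt (by linarith [ht.1]) (by linarith [ht.2])
  · rw [uIcc_of_ge (by linarith)] at ht
    exact mul_nonpos_of_nonneg_of_nonpos (le_of_lt hx)
      (Real.sin_nonpos_of_nonpos_of_neg_pi_le ht.2 (by linarith [ht.1]))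
  · rw [uIcc_of_le (by linarith)] at ht
    rw [← sub_add_cancel t Real.pi, Real.sin_add_pi, mul_neg, neg_nonpos]
    exact mul_nonneg (le_of_lt hx)
      (Real.sin_nonneg_of_nonneg_of_le_pi (by linarith [ht.1]) (by linarith [ht.2]))
  · rw [Real.sin_neg, mul_neg, neg_lt_zero]
    exact mul_pos hx (Real.sin_pos_of_pos_of_lt_pi hβ (by linarith))
  · rw [add_comm, Real.sin_add_pi, mul_neg, neg_lt_zero]
    exact mul_pos hx (Real.sin_pos_of_pos_of_lt_pi hβ (by linarith))

/-- For `x < 0` the outer rays go into the upper half-plane, where `φ_0` converges unchanged. -/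
lemma exists_hasDerivAt_of_neg (hμ : ∀ t : ℝ, charFun μ t = (phi d 0 t - phi d Real.pi t) ^ n)
    (hd : 0 < d) (hε : 0 < ε) (hεd : ε * d < Real.pi / 4) {θ' η' : ℝ}
    (h₁' : IsContinuation d 0 (ε * d) Real.pi θ')
    (h₂' : IsContinuation d Real.pi (Real.pi - ε * d) Real.pi η') {x : ℝ} (hx : x < 0) :
    ∃ y : ℝ, HasDerivAt (fun c => μ.real (Iio c)) y x ∧
      GivenByContours d n x y 0 θ' (ε * d) 0 η' (Real.pi - ε * d) := by
  have hπ := Real.pi_pos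
  have hβ : 0 < ε * d := mul_pos hε (Nat.cast_pos.2 hd)
  have hβπ : ε * d ≤ Real.pi := by linarith
  have h₁ : IsContinuation d 0 (ε * d) 0 0 := by
    simpa using isContinuation_self (d := d) (b := 0) (θ₀ := 0) (Or.inl rfl)
      (by simp) (by simp) hβ.le hβπ
  have h₂ : IsContinuation d Real.pi (Real.pi - ε * d) 0 0 := by
    simpa [← sub_eq_add_neg] using isContinuation_self (d := d) (b := Real.pi) (θ₀ := 0)
      (Or.inr rfl) (by simp) (by simp) hβ.le hβπ
  refine hasDerivAt_and_givenByContours hμ h₁ h₁' h₂ h₂' (fun t ht => ?_) (fun t ht => ?_)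
    isOpen_Iio ordConnected_Iio (fun x hx t ht => ?_) (fun x hx t ht => ?_) (fun x hx => ?_)
    (fun x hx => ?_) hx
  · rw [uIcc_of_le (by linarith)] at ht
    exact Real.cos_pos_of_mem_Ioo ⟨by linarith [ht.1], by linarith [ht.2]⟩
  · rw [uIcc_of_ge (by linarith)] at ht
    exact Real.cos_neg_of_pi_div_two_lt_of_lt (by linarith [ht.1]) (by linarith [ht.2])
  · rw [uIcc_of_le (by linarith)] at ht
    exact mul_nonpos_of_nonpos_of_nonneg (le_of_lt hx)
      (Real.sin_nonneg_of_nonneg_of_le_pi ht.1 (by linarith [ht.2]))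
  · rw [uIcc_of_ge (by linarith)] at ht
    exact mul_nonpos_of_nonpos_of_nonneg (le_of_lt hx)
      (Real.sin_nonneg_of_nonneg_of_le_pi (by linarith [ht.1]) ht.2)
  · exact mul_neg_of_neg_of_pos hx (Real.sin_pos_of_pos_of_lt_pi hβ (by linarith))
  · rw [Real.sin_pi_sub]
    exact mul_neg_of_neg_of_pos hx (Real.sin_pos_of_pos_of_lt_pi hβ (by linarith))

/-- For odd `d`, `φ_π` lives on the lower half-plane, opposite to `φ_0`, so exactly one of the two
has to be turned. -/
lemma exists_hasDerivAt_of_odd (hμ : ∀ t : ℝ, charFun μ t = (phi d 0 t - phi d Real.pi t) ^ n)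
    (hd : Odd d) (hε : 0 < ε) (hε4 : ε < Real.pi / 4) (hεd : ε * d < Real.pi / 4) (x : ℝ) :
    (0 < x → ∃ y : ℝ, HasDerivAt (fun c => μ.real (Iio c)) y x ∧
      GivenByContours d n x y ε Real.pi (-(ε * d)) (-ε) Real.pi (Real.pi + ε * d)) ∧
    (x < 0 → ∃ y : ℝ, HasDerivAt (fun c => μ.real (Iio c)) y x ∧
      GivenByContours d n x y 0 (Real.pi - ε) (ε * d) 0 (Real.pi + ε) (Real.pi - ε * d)) := by
  have hπ := Real.pi_pos
  have hβ : 0 ≤ ε * d := mul_nonneg hε.le d.cast_nonneg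
  have hβπ : ε * d ≤ Real.pi := by linarith
  have s₁ (x : ℝ) : Real.sin (x + 0 + d * Real.pi) = -1 * Real.sin x := by
    rw [sin_add_odd_mul_pi hd, add_zero, neg_one_mul]
  have s₂ (x : ℝ) : Real.sin (x + Real.pi + d * Real.pi) = 1 * Real.sin x := by
    rw [sin_add_odd_mul_pi hd, Real.sin_add_pi, neg_neg, one_mul]
  constructor
  · refine exists_hasDerivAt_of_pos hμ hd.pos hε hε4 hεd ?_ ?_
    · simpa using isContinuation_self (Or.inr rfl) s₁ (by simp) hβ hβπ
    · simpa using isContinuation_self (Or.inl rfl) s₂ (by simp) hβ hβπ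
  · refine exists_hasDerivAt_of_neg hμ hd.pos hε hεd ?_ ?_
    · simpa [← sub_eq_add_neg] using
        isContinuation_rotate (Or.inr rfl) s₁ cos_two_mul_pi_add hε.le hε4 hβπ
    · simpa [← sub_eq_add_neg] using
        isContinuation_rotate (Or.inl rfl) s₂ cos_two_mul_pi_add hε.le hε4 hβπ

/-- For even `d`, `φ_π` and `φ_0` share the upper half-plane, so both are turned or neither. -/
lemma exists_hasDerivAt_of_even (hμ : ∀ t : ℝ, charFun μ t = (phi d 0 t - phi d Real.pi t) ^ n)
    (hd : Even d) (hd0 : 0 < d) (hε : 0 < ε) (hε4 : ε < Real.pi / 4) (hεd : ε * d < Real.pi / 4)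
    (x : ℝ) :
    (0 < x → ∃ y : ℝ, HasDerivAt (fun c => μ.real (Iio c)) y x ∧
      GivenByContours d n x y ε (Real.pi + ε) (-(ε * d)) (-ε) (Real.pi - ε)
        (Real.pi + ε * d)) ∧
    (x < 0 → ∃ y : ℝ, HasDerivAt (fun c => μ.real (Iio c)) y x ∧
      GivenByContours d n x y 0 Real.pi (ε * d) 0 Real.pi (Real.pi - ε * d)) := by
  have hπ := Real.pi_pos
  have hβ : 0 ≤ ε * d := mul_nonneg hε.le d.cast_nonneg
  have hβπ : ε * d ≤ Real.pi := by linarith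
  have s₁ (x : ℝ) : Real.sin (x + 0 + d * Real.pi) = 1 * Real.sin x := by
    rw [sin_add_even_mul_pi hd, add_zero, one_mul]
  have s₂ (x : ℝ) : Real.sin (x + Real.pi + d * Real.pi) = -1 * Real.sin x := by
    rw [sin_add_even_mul_pi hd, Real.sin_add_pi, neg_one_mul]
  constructor
  · refine exists_hasDerivAt_of_pos hμ hd0 hε hε4 hεd ?_ ?_
    · simpa using isContinuation_rotate (Or.inl rfl) s₁ cos_two_mul_pi_add hε.le hε4 hβπ
    · simpa [← sub_eq_add_neg] using
        isContinuation_rotate (Or.inr rfl) s₂ cos_two_mul_pi_add hε.le hε4 hβπ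
  · refine exists_hasDerivAt_of_neg hμ hd0 hε hεd ?_ ?_
    · simpa using isContinuation_self (Or.inl rfl) s₁ (by simp) hβ hβπ
    · simpa [← sub_eq_add_neg] using isContinuation_self (Or.inr rfl) s₂ (by simp) hβ hβπ

lemma exists_hasDerivAt (hμ : ∀ t : ℝ, charFun μ t = (phi d 0 t - phi d Real.pi t) ^ n)
    (hd0 : 0 < d) (hε : 0 < ε) (hε4 : ε < Real.pi / 4) (hεd : ε * d < Real.pi / 4) {x : ℝ}
    (hx : x ≠ 0) : ∃ y : ℝ, HasDerivAt (fun c => μ.real (Iio c)) y x := by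
  rcases Nat.even_or_odd d with hd | hd <;> rcases hx.lt_or_gt with h | h
  · exact ((exists_hasDerivAt_of_even hμ hd hd0 hε hε4 hεd x).2 h).imp fun _ h => h.1
  · exact ((exists_hasDerivAt_of_even hμ hd hd0 hε hε4 hεd x).1 h).imp fun _ h => h.1
  · exact ((exists_hasDerivAt_of_odd hμ hd hε hε4 hεd x).2 h).imp fun _ h => h.1
  · exact ((exists_hasDerivAt_of_odd hμ hd hε hε4 hεd x).1 h).imp fun _ h => h.1

end Contours

end PoweredNormal

end

open PoweredNormal in
theorem mainTheorem2 (d : ℕ) (hd : 3 ≤ d) :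
    ∃ ε₀ : ℝ, 0 < ε₀ ∧
      ∀ (n : ℕ), 1 ≤ n →
      ∀ {Ω : Type*} [MeasurableSpace Ω] (P : Measure Ω) [IsProbabilityMeasure P]
        (X : Fin n → Ω → ℝ),
        (∀ k, HasLaw (X k) (gaussianReal 0 1) P) → iIndepFun X P →
      ∃ f : ℝ → ℝ,
        PoweredNormal.IsDensityAwayFromZero P (fun ω => ∑ k, X k ω ^ d) f ∧
        ∀ ε : ℝ, 0 < ε → ε < ε₀ →
          (Odd d →
            (∀ x : ℝ, 0 < x → PoweredNormal.GivenByContours d n x (f x)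
              ε Real.pi (-(ε * d))
              (-ε) Real.pi (Real.pi + ε * d)) ∧
            (∀ x : ℝ, x < 0 → PoweredNormal.GivenByContours d n x (f x)
              0 (Real.pi - ε) (ε * d)
              0 (Real.pi + ε) (Real.pi - ε * d))) ∧
          (Even d →
            (∀ x : ℝ, 0 < x → PoweredNormal.GivenByContours d n x (f x)
              ε (Real.pi + ε) (-(ε * d))
              (-ε) (Real.pi - ε) (Real.pi + ε * d)) ∧
            (∀ x : ℝ, x < 0 → PoweredNormal.GivenByContours d n x (f x)
              0 Real.pi (ε * d)
              0 Real.pi (Real.pi - ε * d))) := by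
  have hd0 : 0 < d := by omega
  have hdR : (0 : ℝ) < d := Nat.cast_pos.2 hd0
  have hd1 : (1 : ℝ) ≤ d := Nat.one_le_cast.2 hd0
  have hε₀ : 0 < Real.pi / 4 / d := div_pos (by positivity) hdR
  have hsmall {ε : ℝ} (hε : 0 < ε) (h : ε < Real.pi / 4 / d) :
      ε < Real.pi / 4 ∧ ε * d < Real.pi / 4 := by
    have h' := (lt_div_iff₀ hdR).1 h
    exact ⟨(le_mul_of_one_le_right hε.le hd1).trans_lt h', h'⟩
  -- This bound gives `cos 2ε > 0` for the inner rays, and `εd < π/4` keeps the outer rays on their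
  -- side of the imaginary axis.
  refine ⟨Real.pi / 4 / d, hε₀, fun n hn Ω _ P _ X hlaw hX => ?_⟩
  have hmeas := aemeasurable_sum_pow hlaw d
  have hprob := Measure.isProbabilityMeasure_map hmeas
  have hac := map_sum_pow_absolutelyContinuous hlaw hX hd0.ne' hn
  have hnull := nullSingletonClass_of_absolutelyContinuous hac
  have hchar := charFun_map_sum_pow hlaw hX d
  set μ := P.map fun ω => ∑ k, X k ω ^ d with hμ
  set F : ℝ → ℝ := fun c => μ.real (Iio c) with hF
  have hPF : (fun c : ℝ => P.real {ω | ∑ k, X k ω ^ d < c}) = F := by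
    ext c
    exact (map_measureReal_apply_of_aemeasurable hmeas measurableSet_Iio).symm
  have hmono : Monotone F := fun a b hab => measureReal_mono (Iio_subset_Iio hab)
  have hderiv (x : ℝ) (hx : x ≠ 0) : HasDerivAt F (deriv F x) x := by
    obtain ⟨h4, hd4⟩ := hsmall (half_pos hε₀) (half_lt_self hε₀)
    obtain ⟨y, hy⟩ := exists_hasDerivAt hchar hd0 (half_pos hε₀) h4 hd4 hx
    exact hy.differentiableAt.hasDerivAt
  -- Uniqueness of the derivative lets one density serve every `ε`.
  have key {x : ℝ} {p : ℝ → Prop} (h : ∃ y, HasDerivAt F y x ∧ p y) : p (deriv F x) := by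
    obtain ⟨y, hy, hp⟩ := h
    rwa [hy.deriv]
  refine ⟨deriv F, ⟨fun x => hmono.deriv_nonneg, measurable_deriv F,
    eq_withDensity_of_hasDerivAt hac hderiv, fun x hx => ?_⟩, fun ε hε hεlt => ?_⟩
  · rw [hPF]
    exact hderiv x hx
  · obtain ⟨h4, hd4⟩ := hsmall hε hεlt
    exact ⟨fun hodd =>
      ⟨fun x hx => key ((exists_hasDerivAt_of_odd hchar hodd hε h4 hd4 x).1 hx),
        fun x hx => key ((exists_hasDerivAt_of_odd hchar hodd hε h4 hd4 x).2 hx)⟩,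
      fun heven =>
      ⟨fun x hx => key ((exists_hasDerivAt_of_even hchar heven hd0 hε h4 hd4 x).1 hx),
        fun x hx => key ((exists_hasDerivAt_of_even hchar heven hd0 hε h4 hd4 x).2 hx)⟩⟩
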